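/- A plane Cremona map is a birational map $\varphi\colon\mathbb{P}^2\dashrightarrow\mathbb{P}^2$ over $\mathbb{C}$; it can be written $[x:y:z]\mapsto[f_0:f_1:f_2]$ with $f_0,f_1,f_2\in\mathbb{C}[x,y,z]$ homogeneous of the same degree $d$ and without common factor, and $d$ is called the degree of $\varphi$. Maps of degree $1$ are the automorphisms of $\mathbb{P}^2$, and maps of degree $2$ are called quadratic. The map $\varphi$ is called de Jonquières if its degree is $d$ and the linear system spanned by $f_0,f_1,f_2$ has multiplicity $d-1$ at some proper or infinitely near point of $\mathbb{P}^2$. Let $\sigma([x:y:z])=[yz:xz:xy]$. The ordinary quadratic length $\mathrm{oq}(\varphi)$ is the minimum $n\ge 0$ such that $\varphi=\alpha_n\circ\sigma\circ\alpha_{n-1}\circ\sigma\circ\cdots\circ\alpha_1\circ\sigma\circ\alpha_0$ with $\alpha_0,\ldots,\alpha_n\in\mathrm{Aut}(\mathbb{P}^2)$. The quadratic length $\mathrm{q}(\varphi)$ is $0$ if $\varphi$ is an automorphism, and otherwise it is the minimum $n\ge 1$ such that $\varphi=\psi_n\circ\cdots\circ\psi_1$ with quadratic plane Cremona maps $\psi_1,\ldots,\psi_n$.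 Let $\varphi$ be a de Jonquières plane Cremona map of degree $d\le 5$. Then $$\mathrm{oq}(\varphi)\ \ge\ \mathrm{q}(\varphi)\ \ge\ d-1 .$$ -/

import Mathlib

open MvPolynomial

noncomputable section

namespace PlaneCremona

/-- Three polynomials in the variables `X 0, X 1, X 2` over `ℂ` (a formula `[f₀ : f₁ : f₂]`). -/
abbrev Triple : Type := Fin 3 → MvPolynomial (Fin 3) ℂ

/-- Substitution: the formula `[g₀(f₀, f₁, f₂) : g₁(f₀, f₁, f₂) : g₂(f₀, f₁, f₂)]` of `g ∘ f`. -/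
def Triple.comp (g f : Triple) : Triple := fun i => bind₁ f (g i)

/-- `k` is a non-zero polynomial multiple of `f`. If `f` has no common factor, this says exactly
that `k` is non-zero and defines the same rational map as `f`. -/
def Triple.Represents (k f : Triple) : Prop :=
  ∃ h : MvPolynomial (Fin 3) ℂ, h ≠ 0 ∧ ∀ i, k i = h * f i

/-- The formula `[x : y : z]` of the identity. -/
def Triple.id : Triple := fun i => X i

/-- The rational map with formula `f` has an inverse rational map. -/
def Triple.IsBirational (f : Triple) : Prop :=
  ∃ (e : ℕ) (g : Triple), (∀ i, (g i).IsHomogeneous e) ∧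
    (g.comp f).Represents Triple.id ∧ (f.comp g).Represents Triple.id

end PlaneCremona

/-- A plane Cremona map `ℙ² ⇢ ℙ²` over `ℂ`, given by homogeneous polynomials of the same degree
without common factor, which are unique up to a common non-zero scalar. -/
structure PlaneCremonaMap where
  /-- the degree of the map -/
  deg : ℕ
  formula : PlaneCremona.Triple
  homogeneous : ∀ i, (formula i).IsHomogeneous deg
  no_common_factor : ∀ h : MvPolynomial (Fin 3) ℂ, (∀ i, h ∣ formula i) → IsUnit h
  birational : formula.IsBirational

namespace PlaneCremona

/-- The formula `[yz : xz : xy]` of the elementary quadratic transformation. -/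
def sigmaFormula : Triple := ![X 1 * X 2, X 0 * X 2, X 0 * X 1]

theorem isUnit_of_dvd_sigmaFormula (h : MvPolynomial (Fin 3) ℂ)
    (hh : ∀ i, h ∣ sigmaFormula i) : IsUnit h := by
  have h0 : h ∣ X 1 * X 2 := hh 0
  have h1 : h ∣ X 0 * X 2 := hh 1
  have h2 : h ∣ X 0 * X 1 := hh 2
  by_contra hu
  have hne : h ≠ 0 := by
    rintro rfl
    rw [zero_dvd_iff] at h0
    exact mul_ne_zero (X_ne_zero (R := ℂ) (1 : Fin 3)) (X_ne_zero 2) h0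
  obtain ⟨p, hp, hph⟩ := WfDvdMonoid.exists_irreducible_factor hu hne
  have hpp : Prime p := hp.prime
  have key : ∀ i j : Fin 3, p ∣ X i → p ∣ X j → i = j := by
    intro i j hi hj
    have hXi : Irreducible (X i : MvPolynomial (Fin 3) ℂ) := (X_prime).irreducible
    have hXj : Irreducible (X j : MvPolynomial (Fin 3) ℂ) := (X_prime).irreducible
    have a : Associated (X i : MvPolynomial (Fin 3) ℂ) (X j) :=
      (hp.associated_of_dvd hXi hi).symm.trans (hp.associated_of_dvd hXj hj)
    exact X_dvd_X.mp a.dvd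
  have k01 := key 0 1
  have k02 := key 0 2
  have k12 := key 1 2
  rcases hpp.dvd_or_dvd (hph.trans h0) with a | a <;>
    rcases hpp.dvd_or_dvd (hph.trans h1) with b | b <;>
    rcases hpp.dvd_or_dvd (hph.trans h2) with c | c <;> simp_all

theorem sigmaFormula_isHomogeneous (i : Fin 3) : (sigmaFormula i).IsHomogeneous 2 := by
  have hX (a b : Fin 3) : (X a * X b : MvPolynomial (Fin 3) ℂ).IsHomogeneous 2 :=
    (isHomogeneous_X ℂ a).mul (isHomogeneous_X ℂ b)
  fin_cases i
  · exact hX 1 2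
  · exact hX 0 2
  · exact hX 0 1

theorem sigmaFormula_isBirational : sigmaFormula.IsBirational := by
  have h : (sigmaFormula.comp sigmaFormula).Represents Triple.id := by
    refine ⟨X 0 * X 1 * X 2, ?_, ?_⟩
    · exact mul_ne_zero (mul_ne_zero (X_ne_zero _) (X_ne_zero _)) (X_ne_zero _)
    · intro i
      fin_cases i <;> simp [Triple.comp, Triple.id, sigmaFormula] <;> ring
  exact ⟨2, sigmaFormula, sigmaFormula_isHomogeneous, h, h⟩

/-! ### Base points, proper and infinitely near, and their multiplicities -/

/-- A point of the bubble space of `ℙ²` in standard coordinates `(p₁, t₂, …, t_r)`: a proper point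
`p₁` of the plane and the coordinates `t₂, …, t_r ∈ ℙ¹ = ℂ ∪ {∞}` of points
`p_r ≻₁ … ≻₁ p₂ ≻₁ p₁`, each in the first neighbourhood of the preceding one. It is a proper point
when the list is empty. -/
structure BubblePoint where
  proper : Projectivization ℂ (Fin 3 → ℂ)
  coords : List (OnePoint ℂ)

/-- Affine coordinates, centred at the point `[v 0 : v 1 : v 2]`, on a standard chart of `ℙ²`
containing it. They do not change if `v` is rescaled. -/
def chart (v : Fin 3 → ℂ) : Fin 3 → MvPolynomial (Fin 2) ℂ :=
  open Classical in
  if v 2 ≠ 0 then ![X 0 + C (v 0 / v 2), X 1 + C (v 1 / v 2), 1]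
  else if v 1 ≠ 0 then ![X 0 + C (v 0 / v 1), 1, X 1]
  else ![1, X 0, X 1]

/-- Local equations at the origin of `ℂ²` of three generators of a linear system of curves. -/
abbrev LocalNet : Type := Fin 3 → MvPolynomial (Fin 2) ℂ

/-- The multiplicity at the origin of the general member of the linear system spanned by
`g 0, g 1, g 2`: the least total degree of a monomial that occurs in one of them. -/
def LocalNet.mult (g : LocalNet) : ℕ :=
  sInf {n : ℕ | ∃ i, ∃ m ∈ (g i).support, m.degree = n}

/-- The blow-up of the origin of `ℂ²` in coordinates centred at the point `t` of the exceptional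
curve, which has the equation `X 0 = 0` in them: `(x, y) ↦ (x, x (y + t))` for `t ∈ ℂ`, and
`(x, y) ↦ (x y, x)` for `t = ∞`. -/
def blowUpChart : OnePoint ℂ → Fin 2 → MvPolynomial (Fin 2) ℂ
  | some t => ![X 0, X 0 * (X 1 + C t)]
  | none => ![X 0 * X 1, X 0]

/-- The strict transform of the linear system near the point `t` of the exceptional curve:
pull back and divide by the `g.mult`-th power of the equation of the exceptional curve. -/
def LocalNet.strictTransform (g : LocalNet) (t : OnePoint ℂ) : LocalNet :=
  fun i => (bind₁ (blowUpChart t) (g i)).divMonomial (Finsupp.single 0 g.mult)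

/-- The multiplicity of the linear system at the point with coordinates `t₂, …, t_r` infinitely
near the origin. -/
def LocalNet.multAt : LocalNet → List (OnePoint ℂ) → ℕ
  | g, [] => g.mult
  | g, t :: ts => (g.strictTransform t).multAt ts

end PlaneCremona

namespace PlaneCremonaMap

open PlaneCremona

/-- `φ = ψ ∘ χ` as rational maps. -/
def IsComp (φ ψ χ : PlaneCremonaMap) : Prop :=
  (ψ.formula.comp χ.formula).Represents φ.formula

/-- The elementary quadratic transformation `[x : y : z] ↦ [yz : xz : xy]`. -/
def sigma : PlaneCremonaMap where
  deg := 2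
  formula := sigmaFormula
  homogeneous := sigmaFormula_isHomogeneous
  no_common_factor := isUnit_of_dvd_sigmaFormula
  birational := sigmaFormula_isBirational

/-- The multiplicity of the linear system defining `φ` at a proper or infinitely near point;
`p` is a base point of `φ` when this is positive. -/
def mult (φ : PlaneCremonaMap) (p : BubblePoint) : ℕ :=
  LocalNet.multAt (fun i => bind₁ (chart p.proper.rep) (φ.formula i)) p.coords

/-- Automorphisms of `ℙ²`, the maps of degree `1`. -/
def IsAutomorphism (φ : PlaneCremonaMap) : Prop := φ.deg = 1

/-- Quadratic maps. -/
def IsQuadratic (φ : PlaneCremonaMap) : Prop := φ.deg = 2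

/-- De Jonquières maps: a map of degree `d` having a point of multiplicity `d - 1`.
(If `d = 1`, the multiplicity is `0`, and every automorphism is admitted.) -/
def IsDeJonquieres (φ : PlaneCremonaMap) : Prop :=
  ∃ p : BubblePoint, φ.mult p + 1 = φ.deg

/-- `φ = αₙ ∘ σ ∘ αₙ₋₁ ∘ σ ∘ ⋯ ∘ α₁ ∘ σ ∘ α₀` with automorphisms `α₀, …, αₙ`. -/
inductive OrdinaryDecomposition : ℕ → PlaneCremonaMap → Prop
  | aut (α : PlaneCremonaMap) : α.IsAutomorphism → OrdinaryDecomposition 0 α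
  | step (n : ℕ) (φ ψ α ρ : PlaneCremonaMap) : OrdinaryDecomposition n ψ → α.IsAutomorphism →
      ρ.IsComp α sigma → φ.IsComp ρ ψ → OrdinaryDecomposition (n + 1) φ

/-- `φ = ρₙ ∘ ⋯ ∘ ρ₁ ∘ α` with quadratic maps `ρ₁, …, ρₙ` and an automorphism `α`. For `n ≥ 1` this
means that `φ` is a composition of `n` quadratic maps, since `ρ₁ ∘ α` is quadratic; for `n = 0` it
means that `φ` is an automorphism. -/
inductive QuadraticDecomposition : ℕ → PlaneCremonaMap → Prop
  | aut (α : PlaneCremonaMap) : α.IsAutomorphism → QuadraticDecomposition 0 α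
  | step (n : ℕ) (φ ψ ρ : PlaneCremonaMap) : QuadraticDecomposition n ψ → ρ.IsQuadratic →
      φ.IsComp ρ ψ → QuadraticDecomposition (n + 1) φ

/-- The ordinary quadratic length. -/
def ordinaryQuadraticLength (φ : PlaneCremonaMap) : ℕ∞ :=
  ⨅ (n : ℕ) (_ : OrdinaryDecomposition n φ), (n : ℕ∞)

/-- The quadratic length. -/
def quadraticLength (φ : PlaneCremonaMap) : ℕ∞ :=
  ⨅ (n : ℕ) (_ : QuadraticDecomposition n φ), (n : ℕ∞)

end PlaneCremonaMap

end

/-!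
The first inequality holds because a decomposition into maps `α ∘ σ` is a decomposition into
quadratic maps.

For the second one, a composition of `n` quadratic maps has degree at most `2 ^ n`. Hence only two
cases are to be excluded: a de Jonquières map `φ` of degree `4` which is a composition of two
quadratic maps, and one of degree `5` which is a composition of three. Multiplicities do not
increase along infinitely near points, so `φ` has a proper point of multiplicity `d - 1`; with this
point at `[0 : 0 : 1]`, the formula of `φ` has degree at most `1` in the last variable
(`PlaneCremonaMap.IsDeJonquieres.exists_lin`).

Write `ξ ∘ f = h φ` where `f` is the first quadratic map, `ξ` the composition of the remaining ones
without its common factors, and `h` is a polynomial. A prime divisor `p` of `h` (of the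
corresponding polynomial for `f⁻¹ ∘ f`, if `h` is constant) is the equation of a curve that is
mapped into finitely many points and thus contracted (`exists_dvd_linear_of_dvd_comp`). Then `p` is
linear, and in suitable coordinates `f = [p x : p y : F]` (`exists_pencilMap`). Such a map and its
inverse act by Möbius transformations on the lines through `[0 : 0 : 1]` (`pencilMap_inverse`), so
that composing with them preserves the degree along these lines, which is the degree minus the
multiplicity at `[0 : 0 : 1]` (`degreeOf_two_le_of_pencilMap`).

If the centre of this pencil of lines is the point of multiplicity `d - 1` of `φ`, then `ξ` is de
Jonquières as well, and `p ^ (deg ξ - 1)` divides `h`. Otherwise the multiplicity of `φ` at the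
centre is at most `1`, as the net would contain the line through the two points if it were at
least `2`; hence `deg ξ` minus the multiplicity of `ξ` at the image of `p = 0` is at least `d - 1`
(`exists_lin_of_comp_quadratic`). For `d = 4` we have `deg ξ = 2` and `h` is constant, and both
alternatives are absurd. For `d = 5` the degree of `h` is `2 deg ξ - 5 > 0`, so `p` divides `h` and
the image of `p = 0` is a base point of `ξ`, which excludes the second alternative since
`deg ξ ≤ 4`; in the first one either `deg ξ = 4`, contrary to the case `d = 4`, or `deg ξ = 3`, and
`p ^ 2` divides a linear form.
-/

noncomputable section

namespace PlaneCremona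

/-! ### Homogeneous polynomials, divisibility and degrees in one variable -/

/-- Substituting `c * t i` into a homogeneous polynomial pulls out a power of `c`. -/
theorem aeval_mul_of_isHomogeneous {σ S : Type*} [CommRing S] [Algebra ℂ S]
    {P : MvPolynomial σ ℂ} {n : ℕ} (hP : P.IsHomogeneous n) (c : S) (t : σ → S) :
    aeval (fun i => c * t i) P = c ^ n * aeval t P := by
  simp only [aeval_def, eval₂_eq, Finset.mul_sum]
  refine Finset.sum_congr rfl fun m hm => ?_
  rw [Finset.prod_congr rfl fun i _ => mul_pow c (t i) (m i), Finset.prod_mul_distrib,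
    Finset.prod_pow_eq_pow_sum]
  have : ∑ i ∈ m.support, m i = n := by
    rw [← hP.degree_eq_sum_deg_support hm]
  rw [this]; ring

theorem bind₁_mul_of_isHomogeneous {σ τ : Type*} {P : MvPolynomial σ ℂ} {n : ℕ}
    (hP : P.IsHomogeneous n) (c : MvPolynomial τ ℂ) (t : σ → MvPolynomial τ ℂ) :
    bind₁ (fun i => c * t i) P = c ^ n * bind₁ t P :=
  aeval_mul_of_isHomogeneous hP c t

/-- The grading as a one-parameter substitution: `P ↦ P(T x)`, whose coefficients in `T` are the
homogeneous components of `P`. -/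
def scaling (σ : Type*) : MvPolynomial σ ℂ →ₐ[ℂ] Polynomial (MvPolynomial σ ℂ) :=
  aeval fun i => Polynomial.C (X i) * Polynomial.X

theorem coeff_scaling {σ : Type*} (P : MvPolynomial σ ℂ) (n : ℕ) :
    (scaling σ P).coeff n = homogeneousComponent n P := by
  classical
  induction P using MvPolynomial.induction_on' with
  | add p q hp hq => simp [hp, hq]
  | monomial m a =>
    have h : scaling σ (monomial m a) = Polynomial.C (monomial m a) * Polynomial.X ^ m.degree := by
      rw [scaling, aeval_monomial]
      simp only [Finsupp.prod, mul_pow, Finset.prod_mul_distrib, Finset.prod_pow_eq_pow_sum]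
      rw [MvPolynomial.monomial_eq, map_mul, Finsupp.prod, map_prod, Finsupp.degree]
      simp only [map_pow, mul_assoc]
      rfl
    rw [h, Polynomial.coeff_C_mul, Polynomial.coeff_X_pow, homogeneousComponent_apply]
    by_cases ha : a = 0
    · simp [ha]
    rw [support_monomial, if_neg ha, Finset.filter_singleton]
    by_cases hn : n = m.degree
    · simp [hn]
    · simp [hn, Ne.symm hn]

theorem isHomogeneous_iff_scaling {σ : Type*} (P : MvPolynomial σ ℂ) (n : ℕ) :
    P.IsHomogeneous n ↔ scaling σ P = Polynomial.C P * Polynomial.X ^ n := by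
  constructor
  · intro h
    ext1 k
    rw [coeff_scaling, homogeneousComponent_of_mem h, Polynomial.coeff_C_mul, Polynomial.coeff_X_pow]
    simp
  · intro h
    have := congrArg (fun q => q.coeff n) h
    simp only [coeff_scaling, Polynomial.coeff_C_mul, Polynomial.coeff_X_pow, if_true, mul_one]
      at this
    rw [← this]
    exact homogeneousComponent_isHomogeneous n P

/-- Factors of a non-zero homogeneous polynomial are homogeneous: otherwise the product of the
extreme components would give two components of the product. -/
theorem isHomogeneous_of_mul {σ : Type*} {P Q : MvPolynomial σ ℂ} {n : ℕ}
    (h : (P * Q).IsHomogeneous n) (hP : P ≠ 0) (hQ : Q ≠ 0) :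
    ∃ a b, a + b = n ∧ P.IsHomogeneous a ∧ Q.IsHomogeneous b := by
  have hS : ∀ R : MvPolynomial σ ℂ, R ≠ 0 → scaling σ R ≠ 0 := by
    intro R hR h0
    apply hR
    rw [← sum_homogeneousComponent R]
    exact Finset.sum_eq_zero fun i _ => by rw [← coeff_scaling, h0, Polynomial.coeff_zero]
  have hmono : ∀ R : MvPolynomial σ ℂ,
      (scaling σ R).natDegree ≤ (scaling σ R).natTrailingDegree →
      R.IsHomogeneous (scaling σ R).natDegree := by
    intro R hR
    conv_lhs => rw [← sum_homogeneousComponent R]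
    refine IsHomogeneous.sum _ _ _ fun i _ => ?_
    by_cases hi : i = (scaling σ R).natDegree
    · rw [← hi]; exact homogeneousComponent_isHomogeneous i R
    · rw [← coeff_scaling]
      rcases lt_or_gt_of_ne hi with hlt | hgt
      · rw [Polynomial.coeff_eq_zero_of_lt_natTrailingDegree (hlt.trans_le hR)]
        exact isHomogeneous_zero _ _ _
      · rw [Polynomial.coeff_eq_zero_of_natDegree_lt hgt]
        exact isHomogeneous_zero _ _ _
  have e := (isHomogeneous_iff_scaling _ _).1 h
  rw [map_mul] at e
  have hd := congrArg Polynomial.natDegree e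
  have ht := congrArg Polynomial.natTrailingDegree e
  rw [Polynomial.natDegree_mul (hS P hP) (hS Q hQ),
    Polynomial.natDegree_C_mul_X_pow _ _ (mul_ne_zero hP hQ)] at hd
  rw [Polynomial.natTrailingDegree_mul (hS P hP) (hS Q hQ),
    Polynomial.C_mul_X_pow_eq_monomial, Polynomial.natTrailingDegree_monomial (mul_ne_zero hP hQ)]
    at ht
  have h1 := Polynomial.natTrailingDegree_le_natDegree (scaling σ P)
  have h2 := Polynomial.natTrailingDegree_le_natDegree (scaling σ Q)
  exact ⟨_, _, hd, hmono P (by omega), hmono Q (by omega)⟩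

theorem eq_C_of_isHomogeneous_zero {σ : Type*} {P : MvPolynomial σ ℂ} (h : P.IsHomogeneous 0) :
    P = C (coeff 0 P) :=
  totalDegree_eq_zero_iff_eq_C.1 ((totalDegree_zero_iff_isHomogeneous _).2 h)

theorem not_isUnit_of_isHomogeneous {σ : Type*} {P : MvPolynomial σ ℂ} {n : ℕ}
    (h : P.IsHomogeneous n) (hn : n ≠ 0) : ¬ IsUnit P := by
  intro hu
  obtain ⟨c, hc, rfl⟩ := MvPolynomial.isUnit_iff_eq_C_of_isReduced.1 hu
  exact hn (h.inj_right (isHomogeneous_C σ c) hu.ne_zero)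

theorem isUnit_of_isHomogeneous_zero {σ : Type*} {P : MvPolynomial σ ℂ} (h : P.IsHomogeneous 0)
    (hP : P ≠ 0) : IsUnit P := by
  rw [eq_C_of_isHomogeneous_zero h] at hP ⊢
  exact (IsUnit.mk0 _ fun h0 => hP (by rw [h0, C_0])).map C

theorem degreeOf_le_of_dvd {σ : Type*} {P Q : MvPolynomial σ ℂ} (h : P ∣ Q) (hQ : Q ≠ 0) (j : σ) :
    degreeOf j P ≤ degreeOf j Q := by
  obtain ⟨R, rfl⟩ := h
  rw [degreeOf_mul_eq (left_ne_zero_of_mul hQ) (right_ne_zero_of_mul hQ)]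
  exact Nat.le_add_right _ _

/-- The degree of a substitution in one variable, monomial by monomial. -/
theorem degreeOf_bind₁_le {σ τ : Type*} [Fintype σ] (F : σ → MvPolynomial τ ℂ)
    (P : MvPolynomial σ ℂ) (j : τ) (s : ℕ)
    (h : ∀ m ∈ P.support, ∑ i, m i * degreeOf j (F i) ≤ s) : degreeOf j (bind₁ F P) ≤ s := by
  simp only [bind₁, aeval_def, eval₂_eq']
  refine (degreeOf_sum_le _ _ _).trans (Finset.sup_le fun m hm => ?_)
  refine (degreeOf_C_mul_le _ _ _).trans ((degreeOf_prod_le _ _ _).trans (le_trans ?_ (h m hm)))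
  exact Finset.sum_le_sum fun i _ => degreeOf_pow_le _ _ _

/-- If only the variable `k` is replaced by something involving `X j`, and linearly, then the degree
in `X j` after the substitution is at most the degree in `X k` before it. -/
theorem degreeOf_bind₁_le_degreeOf {σ τ : Type*} [Fintype σ] (F : σ → MvPolynomial τ ℂ)
    (P : MvPolynomial σ ℂ) (j : τ) (k : σ) (h0 : ∀ i, i ≠ k → degreeOf j (F i) = 0)
    (h1 : degreeOf j (F k) ≤ 1) : degreeOf j (bind₁ F P) ≤ degreeOf k P := by
  refine degreeOf_bind₁_le F P j _ fun m hm => ?_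
  rw [Finset.sum_eq_single k (fun i _ hi => by rw [h0 i hi, mul_zero]) (by simp)]
  calc m k * degreeOf j (F k) ≤ m k * 1 := Nat.mul_le_mul_left _ h1
    _ ≤ degreeOf k P := by rw [mul_one]; exact degreeOf_le_iff.1 le_rfl m hm

/-! ### Triples without a common factor -/

/-- The three polynomials have no common factor. -/
def Triple.NoCommonFactor (t : Triple) : Prop :=
  ∀ h : MvPolynomial (Fin 3) ℂ, (∀ i, h ∣ t i) → IsUnit h

theorem Triple.NoCommonFactor.exists_ne_zero {t : Triple} (ht : t.NoCommonFactor) :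
    ∃ i, t i ≠ 0 := by
  by_contra! h
  exact not_isUnit_zero (ht 0 fun i => by rw [h i])

theorem Triple.NoCommonFactor.dvd_of_dvd_mul {t : Triple} (ht : t.NoCommonFactor)
    {a b : MvPolynomial (Fin 3) ℂ} (h : ∀ i, a ∣ b * t i) : a ∣ b := by
  by_cases ha : a = 0
  · obtain ⟨i, hi⟩ := ht.exists_ne_zero
    have := h i
    rw [ha, zero_dvd_iff] at this
    rw [(mul_eq_zero.1 this).resolve_right hi]
    exact dvd_zero a
  obtain ⟨a', b', c', hr, rfl, rfl⟩ := UniqueFactorizationMonoid.exists_reduced_factors a ha b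
  refine mul_dvd_mul_left c' (IsUnit.dvd (ht a' fun i => ?_))
  have := h i
  rw [mul_assoc, mul_dvd_mul_iff_left (left_ne_zero_of_mul ha)] at this
  exact hr.dvd_of_dvd_mul_left this

/-- A non-zero triple is the product of its greatest common divisor and a triple without common
factor. -/
theorem Triple.exists_eq_mul_noCommonFactor (t : Triple) (ht : ∃ i, t i ≠ 0) :
    ∃ (c : MvPolynomial (Fin 3) ℂ) (s : Triple), c ≠ 0 ∧ s.NoCommonFactor ∧ ∀ i, t i = c * s i := by
  classical
  let _ : StrongNormalizationMonoid (MvPolynomial (Fin 3) ℂ) :=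
    UniqueFactorizationMonoid.strongNormalizationMonoid
  let _ : NormalizedGCDMonoid (MvPolynomial (Fin 3) ℂ) :=
    UniqueFactorizationMonoid.toNormalizedGCDMonoid _
  obtain ⟨s, hs, h1⟩ := Finset.extract_gcd t (Finset.univ_nonempty (α := Fin 3))
  refine ⟨Finset.univ.gcd t, s, ?_, fun h hh => ?_, fun i => hs i (Finset.mem_univ i)⟩
  · rw [Ne, Finset.gcd_eq_zero_iff]
    push Not
    exact ht.imp fun i hi => ⟨Finset.mem_univ i, hi⟩
  · exact isUnit_of_dvd_one (h1 ▸ Finset.dvd_gcd fun i _ => hh i)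

theorem Triple.isHomogeneous_of_mul {t s : Triple} {c : MvPolynomial (Fin 3) ℂ} {n : ℕ}
    (ht : ∀ i, (t i).IsHomogeneous n) (hc : c ≠ 0) (hs : ∃ i, s i ≠ 0)
    (h : ∀ i, t i = c * s i) :
    ∃ a b, a + b = n ∧ c.IsHomogeneous a ∧ ∀ i, (s i).IsHomogeneous b := by
  obtain ⟨i, hi⟩ := hs
  obtain ⟨a, b, hab, ha, hb⟩ := PlaneCremona.isHomogeneous_of_mul (h i ▸ ht i) hc hi
  refine ⟨a, b, hab, ha, fun j => ?_⟩
  by_cases hj : s j = 0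
  · rw [hj]; exact isHomogeneous_zero _ _ _
  obtain ⟨a', b', hab', ha', hb'⟩ := PlaneCremona.isHomogeneous_of_mul (h j ▸ ht j) hc hj
  have : a = a' := ha.inj_right ha' hc
  have : b = b' := by omega
  rwa [this]

theorem Triple.comp_assoc (k g f : Triple) : (k.comp g).comp f = k.comp (g.comp f) := by
  funext i
  simp only [Triple.comp, bind₁_bind₁]
  rfl

theorem Triple.comp_id (f : Triple) : f.comp Triple.id = f := by
  funext i
  simp only [Triple.comp]
  exact DFunLike.congr_fun (bind₁_X_left (σ := Fin 3) (R := ℂ)) (f i)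

theorem Triple.id_comp (f : Triple) : Triple.id.comp f = f := by
  funext i
  simp [Triple.comp, Triple.id]

theorem Triple.comp_isHomogeneous {g f : Triple} {d e : ℕ} (hg : ∀ i, (g i).IsHomogeneous e)
    (hf : ∀ i, (f i).IsHomogeneous d) (i : Fin 3) : (g.comp f i).IsHomogeneous (d * e) :=
  (hg i).aeval f hf

/-- `f` and `g` are formulas of mutually inverse rational maps. -/
def Triple.IsInverse (f g : Triple) : Prop :=
  (g.comp f).Represents Triple.id ∧ (f.comp g).Represents Triple.id

/-- A birational formula has an inverse without common factor. -/
theorem Triple.exists_inverse {f : Triple} {d : ℕ} (hf : ∀ i, (f i).IsHomogeneous d)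
    (hb : f.IsBirational) :
    ∃ (e : ℕ) (g : Triple), (∀ i, (g i).IsHomogeneous e) ∧ g.NoCommonFactor ∧ f.IsInverse g := by
  obtain ⟨e, g, hg, ⟨h, hh, h1⟩, ⟨h', hh', h2⟩⟩ := hb
  have hXnc : Triple.NoCommonFactor Triple.id := by
    intro k hk
    by_contra hu
    have hXi (i : Fin 3) : Irreducible (X i : MvPolynomial (Fin 3) ℂ) := X_prime.irreducible
    have a : Associated k (X 0) := ((hXi 0).dvd_iff.1 (hk 0)).resolve_left hu |>.symm
    have := a.symm.dvd.trans (hk 1)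
    exact absurd (X_dvd_X.1 this) (by decide)
  have hg0 : ∃ i, g i ≠ 0 := by
    by_contra! hz
    have := h1 0
    rw [Triple.comp, hz 0, map_zero] at this
    exact mul_ne_zero hh (X_ne_zero 0) this.symm
  obtain ⟨c, s, hc, hs, hcs⟩ := g.exists_eq_mul_noCommonFactor hg0
  obtain ⟨a, b, -, -, hb⟩ := Triple.isHomogeneous_of_mul hg hc hs.exists_ne_zero hcs
  refine ⟨b, s, hb, hs, ?_, ?_⟩
  · have e1 : ∀ i, bind₁ f c * s.comp f i = h * Triple.id i := fun i => by
      rw [← h1 i, Triple.comp, Triple.comp, hcs i, map_mul]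
    obtain ⟨k, rfl⟩ := hXnc.dvd_of_dvd_mul fun i => Dvd.intro _ (e1 i)
    refine ⟨k, right_ne_zero_of_mul hh, fun i => ?_⟩
    have := e1 i
    rw [mul_assoc] at this
    exact mul_left_cancel₀ (left_ne_zero_of_mul hh) this
  · have e2 : ∀ i, c ^ d * f.comp s i = h' * Triple.id i := fun i => by
      rw [← h2 i, Triple.comp, Triple.comp, ← bind₁_mul_of_isHomogeneous (hf i), funext hcs]
    obtain ⟨k, rfl⟩ := hXnc.dvd_of_dvd_mul fun i => Dvd.intro _ (e2 i)
    refine ⟨k, right_ne_zero_of_mul hh', fun i => ?_⟩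
    have := e2 i
    rw [mul_assoc] at this
    exact mul_left_cancel₀ (left_ne_zero_of_mul hh') this

/-! ### Linear changes of coordinates -/

/-- The linear substitution with matrix `A`. -/
def lin (A : Matrix (Fin 3) (Fin 3) ℂ) : Triple := fun i => ∑ j, C (A i j) * X j

theorem lin_isHomogeneous (A : Matrix (Fin 3) (Fin 3) ℂ) (i : Fin 3) :
    (lin A i).IsHomogeneous 1 :=
  IsHomogeneous.sum _ _ _ fun j _ => isHomogeneous_C_mul_X _ j

theorem lin_comp_apply (A : Matrix (Fin 3) (Fin 3) ℂ) (t : Triple) (i : Fin 3) :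
    (lin A).comp t i = ∑ j, C (A i j) * t j := by
  simp [Triple.comp, lin, map_sum]

theorem lin_comp_lin (A B : Matrix (Fin 3) (Fin 3) ℂ) : (lin A).comp (lin B) = lin (A * B) := by
  funext i
  rw [lin_comp_apply]
  simp only [lin, Matrix.mul_apply, map_sum, map_mul, Finset.mul_sum, Finset.sum_mul]
  rw [Finset.sum_comm]
  simp only [mul_assoc]

theorem lin_one : lin 1 = Triple.id := by
  funext i
  simp [lin, Triple.id, Matrix.one_apply]

theorem lin_comp_isHomogeneous (A : Matrix (Fin 3) (Fin 3) ℂ) {t : Triple} {n : ℕ}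
    (ht : ∀ i, (t i).IsHomogeneous n) (i : Fin 3) : ((lin A).comp t i).IsHomogeneous n := by
  simpa using Triple.comp_isHomogeneous (lin_isHomogeneous A) ht i

theorem comp_lin_isHomogeneous (A : Matrix (Fin 3) (Fin 3) ℂ) {t : Triple} {n : ℕ}
    (ht : ∀ i, (t i).IsHomogeneous n) (i : Fin 3) : (t.comp (lin A) i).IsHomogeneous n := by
  simpa using Triple.comp_isHomogeneous ht (lin_isHomogeneous A) i

theorem bind₁_lin_bind₁_lin {A A' : Matrix (Fin 3) (Fin 3) ℂ} (h : A * A' = 1)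
    (P : MvPolynomial (Fin 3) ℂ) : bind₁ (lin A') (bind₁ (lin A) P) = P := by
  rw [bind₁_bind₁]
  have : (fun i => bind₁ (lin A') (lin A i)) = Triple.id := by
    rw [← lin_one, ← h, ← lin_comp_lin]; rfl
  rw [this]
  exact DFunLike.congr_fun (bind₁_X_left (σ := Fin 3) (R := ℂ)) P

theorem lin_comp_lin_comp {A A' : Matrix (Fin 3) (Fin 3) ℂ} (h : A * A' = 1) (t : Triple) :
    (lin A).comp ((lin A').comp t) = t := by
  rw [← Triple.comp_assoc, lin_comp_lin, h, lin_one, Triple.id_comp]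

theorem bind₁_lin_ne_zero {A A' : Matrix (Fin 3) (Fin 3) ℂ} (h : A * A' = 1)
    {P : MvPolynomial (Fin 3) ℂ} (hP : P ≠ 0) : bind₁ (lin A) P ≠ 0 := by
  intro h0
  apply hP
  rw [← bind₁_lin_bind₁_lin h P, h0, map_zero]

theorem Triple.NoCommonFactor.comp_lin {t : Triple} (ht : t.NoCommonFactor)
    {A A' : Matrix (Fin 3) (Fin 3) ℂ} (h : A * A' = 1) : (t.comp (lin A)).NoCommonFactor := by
  have h' : A' * A = 1 := mul_eq_one_comm.1 h
  intro k hk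
  have : IsUnit (bind₁ (lin A') k) := by
    refine ht _ fun i => ?_
    have := map_dvd (bind₁ (lin A')) (hk i)
    rwa [Triple.comp, bind₁_lin_bind₁_lin h] at this
  rw [← bind₁_lin_bind₁_lin h' k]
  exact this.map _

theorem Triple.NoCommonFactor.lin_comp {t : Triple} (ht : t.NoCommonFactor)
    {A A' : Matrix (Fin 3) (Fin 3) ℂ} (h : A * A' = 1) : ((lin A).comp t).NoCommonFactor := by
  have h' : A' * A = 1 := mul_eq_one_comm.1 h
  intro k hk
  refine ht k fun i => ?_
  rw [← lin_comp_lin_comp h' t, lin_comp_apply]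
  exact Finset.dvd_sum fun j _ => (hk j).mul_left _

/-- Linear changes of coordinates at the source and at the target preserve mutually inverse
formulas. -/
theorem Triple.IsInverse.conj {f g : Triple} (h : f.IsInverse g)
    {A A' B B' : Matrix (Fin 3) (Fin 3) ℂ} (hA : A * A' = 1) (hB : B * B' = 1) :
    Triple.IsInverse ((lin B).comp (f.comp (lin A))) ((lin A').comp (g.comp (lin B'))) := by
  have hA' : A' * A = 1 := mul_eq_one_comm.1 hA
  have hB' : B' * B = 1 := mul_eq_one_comm.1 hB
  have key : ∀ (C C' : Matrix (Fin 3) (Fin 3) ℂ) (t : Triple), C * C' = 1 →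
      t.Represents Triple.id → ((lin C').comp (t.comp (lin C))).Represents Triple.id := by
    rintro C C' t hC ⟨h, hh, ht⟩
    have hC' : C' * C = 1 := mul_eq_one_comm.1 hC
    refine ⟨bind₁ (lin C) h, bind₁_lin_ne_zero hC hh, fun i => ?_⟩
    have e1 : t.comp (lin C) = fun i => bind₁ (lin C) h * lin C i := by
      funext i
      rw [Triple.comp, ht i, map_mul, Triple.id, bind₁_X_right]
    rw [← lin_one, ← hC', ← lin_comp_lin, lin_comp_apply, lin_comp_apply, e1, Finset.mul_sum]
    exact Finset.sum_congr rfl fun j _ => by ring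
  constructor
  · have e1 : ((lin A').comp (g.comp (lin B'))).comp ((lin B).comp (f.comp (lin A))) =
        (lin A').comp ((g.comp f).comp (lin A)) := by
      simp only [Triple.comp_assoc]
      rw [lin_comp_lin_comp hB']
    rw [e1]
    exact key A A' _ hA h.1
  · have e1 : ((lin B).comp (f.comp (lin A))).comp ((lin A').comp (g.comp (lin B'))) =
        (lin B).comp ((f.comp g).comp (lin B')) := by
      simp only [Triple.comp_assoc]
      rw [lin_comp_lin_comp hA]
    rw [e1]
    exact key B' B _ hB' h.2

/-! ### Multiplicities at infinitely near points and points of high multiplicity -/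

theorem X_pow_mul_X_pow_mul_C (a b : ℕ) (z : ℂ) :
    (X 0 ^ a * X 1 ^ b * C z : MvPolynomial (Fin 2) ℂ) =
      monomial (Finsupp.single 0 a + Finsupp.single 1 b) z := by
  rw [X_pow_eq_monomial, X_pow_eq_monomial, monomial_mul, mul_comm, C_mul_monomial]
  simp

theorem single_add_single_eq_iff (a b : ℕ) (n : Fin 2 →₀ ℕ) :
    Finsupp.single 0 a + Finsupp.single 1 b = n ↔ a = n 0 ∧ b = n 1 := by
  constructor
  · rintro rfl; simp
  · rintro ⟨rfl, rfl⟩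
    ext i
    fin_cases i <;> simp

theorem degree_fin_two (n : Fin 2 →₀ ℕ) : n.degree = n 0 + n 1 := by
  rw [Finsupp.degree_eq_sum, Fin.sum_univ_two]

theorem bind₁_fin_two_eq_sum (F : Fin 2 → MvPolynomial (Fin 2) ℂ) (G : MvPolynomial (Fin 2) ℂ) :
    bind₁ F G = ∑ n ∈ G.support, C (coeff n G) * (F 0 ^ n 0 * F 1 ^ n 1) := by
  simp only [bind₁, aeval_def, eval₂_eq', Fin.prod_univ_two]
  rfl

/-- The strict transform does not vanish identically on the exceptional curve, where it has
degree at most the multiplicity of the blown up point. -/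
theorem exists_coeff_bind₁_blowUpChart_ne_zero (G : MvPolynomial (Fin 2) ℂ) (t : OnePoint ℂ)
    (N : ℕ) (hN : ∃ m ∈ G.support, m.degree = N) :
    ∃ b ≤ N, coeff (Finsupp.single 0 N + Finsupp.single 1 b) (bind₁ (blowUpChart t) G) ≠ 0 := by
  classical
  have hs : (G.support.filter fun m => m.degree = N).Nonempty := by
    obtain ⟨m, hm, h⟩ := hN
    exact ⟨m, Finset.mem_filter.2 ⟨hm, h⟩⟩
  -- The monomial `m` of degree `N` with the largest exponent of `X 1` wins.
  obtain ⟨m, hm, hmax⟩ := Finset.exists_max_image _ (fun m => m 1) hs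
  obtain ⟨hm, hmN⟩ := Finset.mem_filter.1 hm
  have hmax : ∀ n ∈ G.support, n.degree = N → n 1 ≤ m 1 := fun n hn h =>
    hmax n (Finset.mem_filter.2 ⟨hn, h⟩)
  rw [degree_fin_two] at hmN
  have heq : ∀ n : Fin 2 →₀ ℕ, n 0 = m 0 → n 1 = m 1 → n = m := fun n h0 h1 => by
    ext i
    fin_cases i
    · exact h0
    · exact h1
  rcases t with _ | t
  · refine ⟨m 0, by omega, ?_⟩
    have hF : bind₁ (blowUpChart none) G = ∑ n ∈ G.support,
        monomial (Finsupp.single 0 (n 0 + n 1) + Finsupp.single 1 (n 0)) (coeff n G) := by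
      rw [bind₁_fin_two_eq_sum]
      refine Finset.sum_congr rfl fun n _ => ?_
      rw [← X_pow_mul_X_pow_mul_C]
      simp only [blowUpChart, Matrix.cons_val_zero, Matrix.cons_val_one]
      ring
    have : coeff (Finsupp.single 0 N + Finsupp.single 1 (m 0)) (bind₁ (blowUpChart none) G) =
        coeff m G := by
      rw [hF, coeff_sum, Finset.sum_eq_single m]
      · rw [coeff_monomial, if_pos (by rw [hmN])]
      · intro n hn hnm
        rw [coeff_monomial, if_neg]
        rw [single_add_single_eq_iff]
        rintro ⟨h0, h1⟩
        simp at h0 h1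
        exact hnm (heq n h1 (by omega))
      · intro h; exact absurd hm h
    change coeff _ (bind₁ (blowUpChart none) G) ≠ 0
    rw [this]
    exact mem_support_iff.1 hm
  · refine ⟨m 1, by omega, ?_⟩
    have hF : bind₁ (blowUpChart (some t)) G = ∑ n ∈ G.support, ∑ j ∈ Finset.range (n 1 + 1),
        monomial (Finsupp.single 0 (n 0 + n 1) + Finsupp.single 1 j)
          (coeff n G * (t ^ (n 1 - j) * (n 1).choose j)) := by
      rw [bind₁_fin_two_eq_sum]
      refine Finset.sum_congr rfl fun n _ => ?_
      simp only [← X_pow_mul_X_pow_mul_C]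
      simp only [blowUpChart, Matrix.cons_val_zero, Matrix.cons_val_one]
      rw [mul_pow, add_pow, Finset.mul_sum, Finset.mul_sum, Finset.mul_sum]
      refine Finset.sum_congr rfl fun j _ => ?_
      simp only [C_mul, C_pow, map_natCast]
      ring
    have : coeff (Finsupp.single 0 N + Finsupp.single 1 (m 1))
        (bind₁ (blowUpChart (some t)) G) = coeff m G := by
      rw [hF, coeff_sum, Finset.sum_eq_single m]
      · rw [coeff_sum, Finset.sum_eq_single (m 1)]
        · rw [coeff_monomial, if_pos (by rw [hmN])]
          simp
        · intro j _ hj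
          rw [coeff_monomial, if_neg]
          rw [single_add_single_eq_iff]
          rintro ⟨-, h1⟩
          simp at h1
          exact hj h1
        · intro h
          exact absurd (Finset.mem_range.2 (Nat.lt_succ_self _)) h
      · intro n hn hnm
        rw [coeff_sum]
        refine Finset.sum_eq_zero fun j hj => ?_
        rw [coeff_monomial, if_neg]
        rw [single_add_single_eq_iff]
        rintro ⟨h0, h1⟩
        simp at h0 h1
        have := hmax n hn (by rw [degree_fin_two, h0])
        have := Finset.mem_range.1 hj
        exact hnm (heq n (by omega) (by omega))
      · intro h; exact absurd hm h
    change coeff _ (bind₁ (blowUpChart (some t)) G) ≠ 0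
    rw [this]
    exact mem_support_iff.1 hm

theorem LocalNet.mult_strictTransform_le (g : LocalNet) (t : OnePoint ℂ) :
    (g.strictTransform t).mult ≤ g.mult := by
  by_cases hg : {n : ℕ | ∃ i, ∃ m ∈ (g i).support, m.degree = n}.Nonempty
  · obtain ⟨i, hi⟩ := Nat.sInf_mem hg
    obtain ⟨b, hb, hc⟩ := exists_coeff_bind₁_blowUpChart_ne_zero (g i) t _ hi
    refine (Nat.sInf_le ?_).trans hb
    refine ⟨i, Finsupp.single 1 b, ?_, by simp⟩
    rw [mem_support_iff, LocalNet.strictTransform, coeff_divMonomial]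
    exact hc
  · have h0 : ∀ i, g i = 0 := by
      intro i
      by_contra hi
      obtain ⟨m, hm⟩ := support_nonempty.2 hi
      exact hg ⟨_, i, m, hm, rfl⟩
    have : (g.strictTransform t).mult = 0 := by
      have : ∀ i, g.strictTransform t i = 0 := fun i => by
        ext n
        rw [LocalNet.strictTransform, coeff_divMonomial, h0 i, map_zero, coeff_zero, coeff_zero]
      simp [LocalNet.mult, this]
    omega

theorem LocalNet.multAt_le_mult (g : LocalNet) (ts : List (OnePoint ℂ)) :
    g.multAt ts ≤ g.mult := by
  induction ts generalizing g with
  | nil => exact le_rfl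
  | cons t ts ih => exact (ih _).trans (g.mult_strictTransform_le t)

theorem exponents_sum_eq {P : MvPolynomial (Fin 3) ℂ} {d : ℕ} (hP : P.IsHomogeneous d)
    {n : Fin 3 →₀ ℕ} (hn : n ∈ P.support) : n 0 + n 1 + n 2 = d := by
  by_contra h
  refine mem_support_iff.1 hn (hP.coeff_eq_zero ?_)
  rwa [Finsupp.degree_eq_sum, Fin.sum_univ_three]

/-- A homogeneous polynomial of degree `d` that vanishes to order `d - 1` at `[0 : 0 : 1]` has
degree at most `1` in the last variable. -/
theorem degreeOf_two_le_one {P : MvPolynomial (Fin 3) ℂ} {d : ℕ} (hP : P.IsHomogeneous d)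
    (h : ∀ n ∈ (bind₁ ![X 0, X 1, (1 : MvPolynomial (Fin 2) ℂ)] P).support, d ≤ n.degree + 1) :
    degreeOf 2 P ≤ 1 := by
  classical
  refine degreeOf_le_iff.2 fun m hm => ?_
  have hdeg : ∀ n ∈ P.support, n 0 + n 1 + n 2 = d := fun n hn => exponents_sum_eq hP hn
  have e : bind₁ ![X 0, X 1, (1 : MvPolynomial (Fin 2) ℂ)] P = ∑ n ∈ P.support,
      monomial (Finsupp.single 0 (n 0) + Finsupp.single 1 (n 1)) (coeff n P) := by
    simp only [bind₁, aeval_def, eval₂_eq', Fin.prod_univ_three, ← X_pow_mul_X_pow_mul_C]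
    refine Finset.sum_congr rfl fun n _ => ?_
    simp [mul_comm]
  have hc : coeff (Finsupp.single 0 (m 0) + Finsupp.single 1 (m 1))
      (bind₁ ![X 0, X 1, (1 : MvPolynomial (Fin 2) ℂ)] P) = coeff m P := by
    rw [e, coeff_sum, Finset.sum_eq_single m]
    · rw [coeff_monomial, if_pos rfl]
    · intro n hn hnm
      rw [coeff_monomial, if_neg]
      rw [single_add_single_eq_iff]
      rintro ⟨h0, h1⟩
      simp at h0 h1
      refine hnm ?_
      have := hdeg n hn
      have := hdeg m hm
      ext i
      fin_cases i
      · exact h0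
      · exact h1
      · change n 2 = m 2; omega
    · intro h; exact absurd hm h
  have := h _ (mem_support_iff.2 (hc ▸ mem_support_iff.1 hm))
  rw [degree_fin_two] at this
  simp at this
  have := hdeg m hm
  omega

/-- The charts of the plane are linear coordinates with the last one equal to `1`. -/
theorem exists_lin_of_chart (v : Fin 3 → ℂ) : ∃ A A' : Matrix (Fin 3) (Fin 3) ℂ, A * A' = 1 ∧
    chart v = fun i => bind₁ ![X 0, X 1, (1 : MvPolynomial (Fin 2) ℂ)] (lin A i) := by
  unfold chart
  split_ifs with h2 h1
  · refine ⟨!![1, 0, v 0 / v 2; 0, 1, v 1 / v 2; 0, 0, 1],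
      !![1, 0, -(v 0 / v 2); 0, 1, -(v 1 / v 2); 0, 0, 1], ?_, ?_⟩
    · ext i j
      fin_cases i <;> fin_cases j <;> simp [Matrix.mul_apply, Fin.sum_univ_three]
    · funext i
      fin_cases i <;> simp [lin, Fin.sum_univ_three]
  · refine ⟨!![1, 0, v 0 / v 1; 0, 0, 1; 0, 1, 0], !![1, -(v 0 / v 1), 0; 0, 0, 1; 0, 1, 0], ?_, ?_⟩
    · ext i j
      fin_cases i <;> fin_cases j <;> simp [Matrix.mul_apply, Fin.sum_univ_three]
    · funext i
      fin_cases i <;> simp [lin, Fin.sum_univ_three]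
  · refine ⟨!![0, 0, 1; 1, 0, 0; 0, 1, 0], !![0, 1, 0; 0, 0, 1; 1, 0, 0], ?_, ?_⟩
    · ext i j
      fin_cases i <;> fin_cases j <;> simp [Matrix.mul_apply, Fin.sum_univ_three]
    · funext i
      fin_cases i <;> simp [lin, Fin.sum_univ_three]

/-- In suitable coordinates a de Jonquières map has degree at most `1` in the last variable:
multiplicities do not increase along infinitely near points, so that there is a proper point of
multiplicity at least `d - 1`, which can be moved to `[0 : 0 : 1]`. -/
theorem _root_.PlaneCremonaMap.IsDeJonquieres.exists_lin {φ : PlaneCremonaMap}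
    (hφ : φ.IsDeJonquieres) :
    ∃ A A' : Matrix (Fin 3) (Fin 3) ℂ, A * A' = 1 ∧
      ∀ i, degreeOf 2 (φ.formula.comp (lin A) i) ≤ 1 := by
  obtain ⟨p, hp⟩ := hφ
  obtain ⟨A, A', hA, hc⟩ := exists_lin_of_chart p.proper.rep
  refine ⟨A, A', hA, fun i => degreeOf_two_le_one (comp_lin_isHomogeneous A φ.homogeneous i) ?_⟩
  intro n hn
  have h1 := LocalNet.multAt_le_mult
    (fun i => bind₁ (chart p.proper.rep) (φ.formula i)) p.coords
  have h2 : LocalNet.mult (fun i => bind₁ (chart p.proper.rep) (φ.formula i)) ≤ n.degree := by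
    refine Nat.sInf_le ⟨i, n, ?_, rfl⟩
    rw [Triple.comp, bind₁_bind₁, ← hc] at hn
    exact hn
  have h3 : LocalNet.multAt (fun i => bind₁ (chart p.proper.rep) (φ.formula i)) p.coords + 1 =
    φ.deg := hp
  omega

/-! ### Contracted curves -/

/-- Two polynomials in one variable over a factorial ring, one irreducible and not dividing the
other, have a non-zero constant combination: by Gauss's lemma they are coprime over the field of
fractions. -/
theorem exists_C_eq_add {A : Type*} [CommRing A] [IsDomain A] [UniqueFactorizationMonoid A]
    {p q : Polynomial A} (hp : Irreducible p) (hpq : ¬ p ∣ q) :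
    ∃ r : A, r ≠ 0 ∧ ∃ a b, a * p + b * q = Polynomial.C r := by
  by_cases h0 : p.natDegree = 0
  · obtain ⟨c, rfl⟩ := Polynomial.natDegree_eq_zero.1 h0
    exact ⟨c, fun h => hp.ne_zero (by rw [h, Polynomial.C_0]), 1, 0, by simp⟩
  have hprim := hp.isPrimitive h0
  let K := FractionRing A
  let _ : StrongNormalizationMonoid A := UniqueFactorizationMonoid.strongNormalizationMonoid
  let _ : NormalizedGCDMonoid A := UniqueFactorizationMonoid.toNormalizedGCDMonoid _
  have hpK : Irreducible (p.map (algebraMap A K)) :=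
    hprim.irreducible_iff_irreducible_map_fraction_map.1 hp
  have hndvd : ¬ p.map (algebraMap A K) ∣ q.map (algebraMap A K) := fun h =>
    hpq (hprim.dvd_of_fraction_map_dvd_fraction_map h)
  obtain ⟨a, b, hab⟩ := hpK.coprime_iff_not_dvd.2 hndvd
  obtain ⟨u, hu0, hu⟩ := IsLocalization.integerNormalization_spec (nonZeroDivisors A) a
  obtain ⟨v, hv0, hv⟩ := IsLocalization.integerNormalization_spec (nonZeroDivisors A) b
  set a' := IsLocalization.integerNormalization (nonZeroDivisors A) a
  set b' := IsLocalization.integerNormalization (nonZeroDivisors A) b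
  have ea : a'.map (algebraMap A K) = Polynomial.C (algebraMap A K u) * a := by
    rw [hu, Algebra.smul_def]; rfl
  have eb : b'.map (algebraMap A K) = Polynomial.C (algebraMap A K v) * b := by
    rw [hv, Algebra.smul_def]; rfl
  refine ⟨u * v, mul_ne_zero (nonZeroDivisors.ne_zero hu0) (nonZeroDivisors.ne_zero hv0),
    Polynomial.C v * a', Polynomial.C u * b', ?_⟩
  apply Polynomial.map_injective _ (IsFractionRing.injective A K)
  simp only [Polynomial.map_add, Polynomial.map_mul, Polynomial.map_C, ea, eb, map_mul]
  linear_combination (Polynomial.C (algebraMap A K u) * Polynomial.C (algebraMap A K v)) * hab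

/-- Elimination of one of three variables from two polynomials without common factor. -/
theorem exists_rename_eq_add {p q : MvPolynomial (Fin 3) ℂ} (hp : Irreducible p) (hpq : ¬ p ∣ q)
    (e : Equiv.Perm (Fin 3)) :
    ∃ r : MvPolynomial (Fin 2) ℂ, r ≠ 0 ∧ ∃ a b, a * p + b * q = rename (e ∘ Fin.succ) r := by
  let E := (renameEquiv ℂ e.symm).trans (finSuccEquiv ℂ 2)
  obtain ⟨r, hr, a, b, hab⟩ := exists_C_eq_add (p := E p) (q := E q)
    ((MulEquiv.irreducible_iff E).2 hp) (fun h => hpq ((map_dvd_iff E).1 h))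
  refine ⟨r, hr, E.symm a, E.symm b, E.injective ?_⟩
  rw [map_add, map_mul, map_mul, E.apply_symm_apply, E.apply_symm_apply, hab]
  have : (E : MvPolynomial (Fin 3) ℂ →ₐ[ℂ] _).comp (rename (e ∘ Fin.succ)) =
      (Algebra.ofId _ _ : MvPolynomial (Fin 2) ℂ →ₐ[MvPolynomial (Fin 2) ℂ]
        Polynomial (MvPolynomial (Fin 2) ℂ)).restrictScalars ℂ := by
    refine MvPolynomial.algHom_ext fun i => ?_
    simp [E, finSuccEquiv_X_succ, Algebra.ofId_apply]
  exact (DFunLike.congr_fun this r).symm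

theorem dvd_homogeneousComponent {σ : Type*} {p Q : MvPolynomial σ ℂ} {a : ℕ}
    (hp : p.IsHomogeneous a) (h : p ∣ Q) (n : ℕ) : p ∣ homogeneousComponent n Q := by
  obtain ⟨s, rfl⟩ := h
  rw [← coeff_scaling, map_mul, (isHomogeneous_iff_scaling p a).1 hp, mul_assoc,
    Polynomial.coeff_C_mul]
  exact dvd_mul_right _ _

/-- If a prime divides a binary form in `F` and `G`, it divides a linear form in them, since binary
forms over `ℂ` split. -/
theorem exists_dvd_linear_of_dvd_form {r : MvPolynomial (Fin 2) ℂ} (hr : r ≠ 0) {k : ℕ}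
    (hk : r.IsHomogeneous k) {p F G : MvPolynomial (Fin 3) ℂ} (hp : Prime p)
    (h : p ∣ aeval ![F, G] r) : ∃ α β : ℂ, (α ≠ 0 ∨ β ≠ 0) ∧ p ∣ C α * F + C β * G := by
  by_cases hG : p ∣ G
  · exact ⟨0, 1, Or.inr one_ne_zero, by simpa using hG⟩
  have : (Ideal.span {p}).IsPrime := (Ideal.span_singleton_prime hp.ne_zero).2 hp
  let R := MvPolynomial (Fin 3) ℂ ⧸ Ideal.span {p}
  let K := FractionRing R
  let θ : MvPolynomial (Fin 3) ℂ →ₐ[ℂ] K :=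
    (IsScalarTower.toAlgHom ℂ R K).comp (Ideal.Quotient.mkₐ ℂ (Ideal.span {p}))
  have hθ : ∀ P, θ P = 0 ↔ p ∣ P := fun P => by
    rw [← Ideal.mem_span_singleton, ← Ideal.Quotient.eq_zero_iff_mem]
    exact map_eq_zero_iff (algebraMap R K) (IsFractionRing.injective R K)
  have hθG : θ G ≠ 0 := fun h0 => hG ((hθ G).1 h0)
  let f : Polynomial ℂ := aeval ![Polynomial.X, 1] r
  have hf : f ≠ 0 := by
    intro hf
    have hX : (X 1 : MvPolynomial (Fin 2) ℂ) * r = 0 := by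
      refine MvPolynomial.funext fun x => ?_
      rw [map_mul, map_zero, eval_X]
      by_cases hx : x 1 = 0
      · rw [hx, zero_mul]
      · have e1 : x = fun i => x 1 * (![x 0 / x 1, 1] : Fin 2 → ℂ) i := by
          funext i
          fin_cases i
          · simp; field_simp
          · simp
        have e2 : Polynomial.aeval (x 0 / x 1) f = aeval ![x 0 / x 1, (1 : ℂ)] r := by
          rw [comp_aeval_apply]
          congr 2
          funext i
          fin_cases i <;> simp
        have e3 : eval x r = 0 := by
          rw [← aeval_eq_eval]
          nth_rewrite 1 [e1]
          rw [aeval_mul_of_isHomogeneous hk, ← e2, hf, map_zero, mul_zero]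
        rw [e3, mul_zero]
    exact (mul_ne_zero (X_ne_zero 1) hr) hX
  have hroot : Polynomial.aeval (θ F / θ G) f = 0 := by
    have e2 : Polynomial.aeval (θ F / θ G) f = aeval ![θ F / θ G, (1 : K)] r := by
      rw [comp_aeval_apply]
      congr 2
      funext i
      fin_cases i <;> simp
    have e1 : (fun i => θ (![F, G] i)) = fun i => θ G * (![θ F / θ G, 1] : Fin 2 → K) i := by
      funext i
      fin_cases i
      · exact (mul_div_cancel₀ (θ F) hθG).symm
      · simp
    have e3 := (hθ _).2 h
    rw [comp_aeval_apply, e1, aeval_mul_of_isHomogeneous hk, ← e2] at e3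
    exact (mul_eq_zero.1 e3).resolve_left (pow_ne_zero _ hθG)
  have hint : IsIntegral ℂ (θ F / θ G) := isAlgebraic_iff_isIntegral.1 ⟨f, hf, hroot⟩
  obtain ⟨z, hz⟩ := minpoly.mem_range_of_degree_eq_one ℂ (θ F / θ G)
    (IsAlgClosed.degree_eq_one_of_irreducible ℂ (minpoly.irreducible hint))
  refine ⟨1, -z, Or.inl one_ne_zero, (hθ _).1 ?_⟩
  have hzC : θ (C z) = algebraMap ℂ K z := θ.commutes z
  rw [map_add, map_mul, map_mul, C_1, map_one, C_neg, map_neg, hzC, hz, one_mul, neg_mul,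
    div_mul_cancel₀ _ hθG, add_neg_cancel]

/-- A curve that `f` maps into the common zeros of a triple without common factor is contracted:
the components of `f` are pairwise proportional along it. -/
theorem exists_dvd_linear_of_dvd_comp {ξ f : Triple} (hξ : ξ.NoCommonFactor) {n : ℕ} (hn : n ≠ 0)
    (hf : ∀ i, (f i).IsHomogeneous n) {p : MvPolynomial (Fin 3) ℂ} (hp : Prime p) {a : ℕ}
    (hpa : p.IsHomogeneous a) (h : ∀ i, p ∣ ξ.comp f i) (i j : Fin 3) (hij : i ≠ j) :
    ∃ α β : ℂ, (α ≠ 0 ∨ β ≠ 0) ∧ p ∣ C α * f i + C β * f j := by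
  have : (Ideal.span {p}).IsPrime := (Ideal.span_singleton_prime hp.ne_zero).2 hp
  let I := (Ideal.span {p}).comap (bind₁ f)
  have hI : ∀ P, P ∈ I ↔ p ∣ bind₁ f P := fun P => Ideal.mem_span_singleton
  obtain ⟨i₀, hi₀⟩ := hξ.exists_ne_zero
  have hbot : I ≠ ⊥ := fun hb => hi₀ <| by
    rw [← Ideal.mem_bot, ← hb]; exact (hI _).2 (h i₀)
  obtain ⟨q, hqI, hq⟩ := Ideal.IsPrime.exists_mem_prime_of_ne_bot (inferInstance : I.IsPrime) hbot
  obtain ⟨j₀, hj₀⟩ : ∃ j₀, ¬ q ∣ ξ j₀ := by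
    by_contra! hall
    exact hq.not_isUnit (hξ q hall)
  obtain ⟨e, h1, h2⟩ : ∃ e : Equiv.Perm (Fin 3), e 1 = i ∧ e 2 = j := by
    revert i j; decide
  obtain ⟨r, hr, u, v, huv⟩ := exists_rename_eq_add hq.irreducible hj₀ e
  have hrI : p ∣ aeval ![f i, f j] r := by
    have hmem : rename (e ∘ Fin.succ) r ∈ I := by
      rw [← huv]
      exact I.add_mem (I.mul_mem_left _ hqI) (I.mul_mem_left _ ((hI _).2 (h j₀)))
    have := (hI _).1 hmem
    rw [bind₁_rename] at this
    convert this using 2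
    rw [bind₁]
    congr 1
    funext k
    fin_cases k
    · exact (congrArg f h1).symm
    · exact (congrArg f h2).symm
  obtain ⟨k, hk⟩ : ∃ k, homogeneousComponent k r ≠ 0 := by
    by_contra! hall
    apply hr
    rw [← sum_homogeneousComponent r]
    exact Finset.sum_eq_zero fun k _ => hall k
  refine exists_dvd_linear_of_dvd_form hk (homogeneousComponent_isHomogeneous k r) hp ?_
  have hkr : k ∈ Finset.range (r.totalDegree + 1) := by
    by_contra hk'
    exact hk (homogeneousComponent_eq_zero _ _ (by simpa using hk'))
  have hhom : ∀ l, (aeval ![f i, f j] (homogeneousComponent l r)).IsHomogeneous (n * l) := fun l =>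
    (homogeneousComponent_isHomogeneous l r).aeval _ fun m => by
      fin_cases m
      · exact hf i
      · exact hf j
  have := dvd_homogeneousComponent hpa hrI (n * k)
  rw [← sum_homogeneousComponent r, map_sum, map_sum, Finset.sum_eq_single k] at this
  · rwa [homogeneousComponent_of_mem (hhom k), if_pos rfl] at this
  · intro l _ hl
    rw [homogeneousComponent_of_mem (hhom l), if_neg]
    intro h
    exact hl (Nat.eq_of_mul_eq_mul_left (Nat.pos_of_ne_zero hn) h).symm
  · intro h; exact absurd hkr h

/-! ### Maps preserving the pencil of lines through a point -/

/-- The formula `[ℓ x : ℓ y : F]`, which preserves every line through `[0 : 0 : 1]`. -/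
def pencilMap (l F : MvPolynomial (Fin 3) ℂ) : Triple := ![l * X 0, l * X 1, F]

@[simp] theorem pencilMap_zero (l F : MvPolynomial (Fin 3) ℂ) : pencilMap l F 0 = l * X 0 := rfl

@[simp] theorem pencilMap_one (l F : MvPolynomial (Fin 3) ℂ) : pencilMap l F 1 = l * X 1 := rfl

@[simp] theorem pencilMap_two (l F : MvPolynomial (Fin 3) ℂ) : pencilMap l F 2 = F := rfl

theorem eq_sum_monomial_fin_three (P : MvPolynomial (Fin 3) ℂ) :
    P = ∑ m ∈ P.support, C (coeff m P) * (X 0 ^ m 0 * X 1 ^ m 1 * X 2 ^ m 2) := by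
  conv_lhs => rw [P.as_sum]
  refine Finset.sum_congr rfl fun m _ => ?_
  rw [monomial_eq, Finsupp.prod_fintype _ _ (by simp), Fin.prod_univ_three]

theorem exists_eq_of_isHomogeneous_one {P : MvPolynomial (Fin 3) ℂ} (hP : P.IsHomogeneous 1) :
    ∃ a b c : ℂ, P = C a * X 0 + C b * X 1 + C c * X 2 := by
  rw [eq_sum_monomial_fin_three P]
  refine Finset.sum_induction _ (fun Q => ∃ a b c : ℂ, Q = C a * X 0 + C b * X 1 + C c * X 2)
    ?_ ⟨0, 0, 0, by simp⟩ fun m hm => ?_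
  · rintro _ _ ⟨a, b, c, rfl⟩ ⟨a', b', c', rfl⟩
    exact ⟨a + a', b + b', c + c', by simp only [C_add]; ring⟩
  · have h := exponents_sum_eq hP hm
    generalize coeff m P = z
    obtain ⟨h0, h1, h2⟩ | ⟨h0, h1, h2⟩ | ⟨h0, h1, h2⟩ : (m 0 = 1 ∧ m 1 = 0 ∧ m 2 = 0) ∨
        (m 0 = 0 ∧ m 1 = 1 ∧ m 2 = 0) ∨ (m 0 = 0 ∧ m 1 = 0 ∧ m 2 = 1) := by omega
    · exact ⟨z, 0, 0, by simp [h0, h1, h2]⟩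
    · exact ⟨0, z, 0, by simp [h0, h1, h2]⟩
    · exact ⟨0, 0, z, by simp [h0, h1, h2]⟩

theorem exists_eq_of_isHomogeneous_two {P : MvPolynomial (Fin 3) ℂ} (hP : P.IsHomogeneous 2) :
    ∃ a b c d e f : ℂ, P = C a * X 0 ^ 2 + C b * (X 0 * X 1) + C c * X 1 ^ 2 +
      (C d * X 0 + C e * X 1) * X 2 + C f * X 2 ^ 2 := by
  rw [eq_sum_monomial_fin_three P]
  refine Finset.sum_induction _ (fun Q => ∃ a b c d e f : ℂ, Q = C a * X 0 ^ 2 +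
    C b * (X 0 * X 1) + C c * X 1 ^ 2 + (C d * X 0 + C e * X 1) * X 2 + C f * X 2 ^ 2)
    ?_ ⟨0, 0, 0, 0, 0, 0, by simp⟩ fun m hm => ?_
  · rintro _ _ ⟨a, b, c, d, e, f, rfl⟩ ⟨a', b', c', d', e', f', rfl⟩
    exact ⟨a + a', b + b', c + c', d + d', e + e', f + f', by simp only [C_add]; ring⟩
  · have h := exponents_sum_eq hP hm
    generalize coeff m P = z
    obtain ⟨h0, h1, h2⟩ | ⟨h0, h1, h2⟩ | ⟨h0, h1, h2⟩ | ⟨h0, h1, h2⟩ | ⟨h0, h1, h2⟩ |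
        ⟨h0, h1, h2⟩ : (m 0 = 2 ∧ m 1 = 0 ∧ m 2 = 0) ∨ (m 0 = 1 ∧ m 1 = 1 ∧ m 2 = 0) ∨
        (m 0 = 0 ∧ m 1 = 2 ∧ m 2 = 0) ∨ (m 0 = 1 ∧ m 1 = 0 ∧ m 2 = 1) ∨
        (m 0 = 0 ∧ m 1 = 1 ∧ m 2 = 1) ∨ (m 0 = 0 ∧ m 1 = 0 ∧ m 2 = 2) := by omega
    · exact ⟨z, 0, 0, 0, 0, 0, by simp [h0, h1, h2]⟩
    · exact ⟨0, z, 0, 0, 0, 0, by simp [h0, h1, h2]⟩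
    · exact ⟨0, 0, z, 0, 0, 0, by simp [h0, h1, h2]⟩
    · exact ⟨0, 0, 0, z, 0, 0, by simp [h0, h1, h2, mul_assoc]⟩
    · exact ⟨0, 0, 0, 0, z, 0, by simp [h0, h1, h2, mul_assoc]⟩
    · exact ⟨0, 0, 0, 0, 0, z, by simp [h0, h1, h2]⟩

/-- The polynomials `q + r X₂` with `q` and `r` free of `X₂` have degree at most `1` in `X₂`. -/
theorem degreeOf_add_mul_X_two_le {q r : MvPolynomial (Fin 3) ℂ} (hq : degreeOf 2 q = 0)
    (hr : degreeOf 2 r = 0) : degreeOf 2 (q + r * X 2) ≤ 1 := by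
  refine (degreeOf_add_le _ _ _).trans (max_le (by omega) ?_)
  refine (degreeOf_mul_le _ _ _).trans ?_
  rw [hr, degreeOf_X_self]

theorem degreeOf_two_linear (a b : ℂ) :
    degreeOf 2 (C a * X 0 + C b * X 1 : MvPolynomial (Fin 3) ℂ) = 0 := by
  refine Nat.le_zero.1 ((degreeOf_add_le _ _ _).trans (max_le ?_ ?_)) <;>
  exact (degreeOf_C_mul_le _ _ _).trans (by rw [degreeOf_X_of_ne (by decide)])

theorem degreeOf_two_quadratic (a b c : ℂ) :
    degreeOf 2 (C a * X 0 ^ 2 + C b * (X 0 * X 1) + C c * X 1 ^ 2 :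
      MvPolynomial (Fin 3) ℂ) = 0 := by
  refine Nat.le_zero.1 ((degreeOf_add_le _ _ _).trans (max_le
    ((degreeOf_add_le _ _ _).trans (max_le ?_ ?_)) ?_)) <;>
  refine (degreeOf_C_mul_le _ _ _).trans ?_
  · rw [degreeOf_X_pow_of_ne _ (by decide)]
  · refine (degreeOf_mul_le _ _ _).trans ?_
    rw [degreeOf_X_of_ne (by decide), degreeOf_X_of_ne (by decide)]
  · rw [degreeOf_X_pow_of_ne _ (by decide)]

/-- If a birational quadratic map preserves the lines through `[0 : 0 : 1]`, then it and its
inverse restrict to Möbius transformations of these lines. In particular `[0 : 0 : 1]` is a base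
point. -/
theorem pencilMap_inverse {l F : MvPolynomial (Fin 3) ℂ} (hl : l.IsHomogeneous 1)
    (hF : F.IsHomogeneous 2) (hnc : (pencilMap l F).NoCommonFactor) {g : Triple} {e : ℕ}
    (hg : ∀ i, (g i).IsHomogeneous e) (hgnc : g.NoCommonFactor)
    (hinv : (pencilMap l F).IsInverse g) :
    degreeOf 2 l ≤ 1 ∧ degreeOf 2 F ≤ 1 ∧ l ≠ 0 ∧
      ∃ k m, g = pencilMap k m ∧ degreeOf 2 k ≤ 1 ∧ degreeOf 2 m ≤ 1 ∧ k ≠ 0 := by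
  obtain ⟨⟨h, hh, hgf⟩, ⟨h', hh', hfg⟩⟩ := hinv
  have hlF : ¬ l ∣ F := fun hd => not_isUnit_of_isHomogeneous hl one_ne_zero <| hnc l fun i => by
    fin_cases i
    · exact dvd_mul_right _ _
    · exact dvd_mul_right _ _
    · exact hd
  have h0 : bind₁ g l * g 0 = h' * X 0 := by
    have := hfg 0
    simpa [Triple.comp, Triple.id] using this
  have h1 : bind₁ g l * g 1 = h' * X 1 := by
    have := hfg 1
    simpa [Triple.comp, Triple.id] using this
  have h2 : bind₁ g F = h' * X 2 := by
    have := hfg 2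
    simpa [Triple.comp, Triple.id] using this
  have hL : bind₁ g l ≠ 0 := fun hz => by
    rw [hz, zero_mul] at h0
    exact mul_ne_zero hh' (X_ne_zero 0) h0.symm
  have hl0 : l ≠ 0 := fun hz => hL (by rw [hz, map_zero])
  have hx : X 1 * g 0 = X 0 * g 1 := by
    refine mul_left_cancel₀ hL ?_
    linear_combination X 1 * h0 - X 0 * h1
  obtain ⟨k, hk⟩ : X 0 ∣ g 0 := by
    have : (X 0 : MvPolynomial (Fin 3) ℂ) ∣ X 1 * g 0 := hx ▸ dvd_mul_right _ _
    exact ((X_prime).dvd_or_dvd this).resolve_left fun hd => absurd (X_dvd_X.1 hd) (by decide)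
  have hk1 : g 1 = X 1 * k := by
    refine mul_left_cancel₀ (X_ne_zero (R := ℂ) (0 : Fin 3)) ?_
    rw [← hx, hk]; ring
  have hLk : bind₁ g l * k = h' := by
    refine mul_left_cancel₀ (X_ne_zero (R := ℂ) (0 : Fin 3)) ?_
    linear_combination h0 - bind₁ g l * hk
  have hk0 : k ≠ 0 := by
    rintro rfl
    rw [mul_zero] at hLk
    exact hh' hLk.symm
  have hrel : IsRelPrime k (g 2) := fun c hc hc' => hgnc c fun i => by
    fin_cases i
    · exact hk ▸ hc.mul_left _
    · exact hk1 ▸ hc.mul_left _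
    · exact hc'
  obtain ⟨a, b, α, rfl⟩ := exists_eq_of_isHomogeneous_one hl
  obtain ⟨c₀, c₁, c₂, d, e', γ, rfl⟩ := exists_eq_of_isHomogeneous_two hF
  simp only [map_add, map_mul, map_pow, bind₁_X_right, bind₁_C_right] at h2 hLk
  rw [← hLk, hk, hk1] at h2
  have hγ : γ = 0 := by
    by_contra hγ
    -- Otherwise the inverse would be linear.
    have hd : k ∣ C γ * (g 2 * g 2) :=
      ⟨(C a * (X 0 * k) + C b * (X 1 * k) + C α * g 2) * X 2 -
        (k * (C c₀ * X 0 ^ 2 + C c₁ * (X 0 * X 1) + C c₂ * X 1 ^ 2) +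
        g 2 * (C d * X 0 + C e' * X 1)), by linear_combination h2⟩
    have hd : k ∣ g 2 * g 2 := by
      rwa [IsUnit.dvd_mul_left ((IsUnit.mk0 γ hγ).map C)] at hd
    have hku : IsUnit k := hrel (dvd_refl k) (hrel.dvd_of_dvd_mul_left hd)
    obtain ⟨κ, hκ, rfl⟩ := MvPolynomial.isUnit_iff_eq_C_of_isReduced.1 hku
    have hg0 : (g 0).IsHomogeneous 1 := by
      rw [hk]; simpa using (isHomogeneous_X ℂ (0 : Fin 3)).mul (isHomogeneous_C (Fin 3) κ)
    have he : e = 1 := (hg 0).inj_right hg0 (by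
      rw [hk]; exact mul_ne_zero (X_ne_zero 0) hku.ne_zero)
    subst he
    obtain ⟨m₀, m₁, m₂, hm⟩ := exists_eq_of_isHomogeneous_one (hg 2)
    have q0 := hgf 0
    have q2 := hgf 2
    simp only [Triple.comp, hk, hm, Triple.id, map_add, map_mul, bind₁_X_right, bind₁_C_right,
      pencilMap_zero, pencilMap_one, pencilMap_two] at q0 q2
    set l : MvPolynomial (Fin 3) ℂ := C a * X 0 + C b * X 1 + C α * X 2 with hldef
    have hhl : h = l * C κ := by
      refine mul_left_cancel₀ (X_ne_zero (R := ℂ) (0 : Fin 3)) ?_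
      linear_combination -q0
    rw [hhl] at q2
    by_cases hm2 : m₂ = 0
    · rw [hm2, C_0, zero_mul, add_zero] at q2
      have : (C m₀ * X 0 + C m₁ * X 1 : MvPolynomial (Fin 3) ℂ) = C κ * X 2 := by
        refine mul_left_cancel₀ hl0 ?_
        linear_combination q2
      have := congrArg (eval ![0, 0, 1]) this
      simp at this
      exact hκ.ne_zero this.symm
    · refine hlF ?_
      rw [← IsUnit.dvd_mul_left ((IsUnit.mk0 m₂ hm2).map C)]
      refine ⟨C κ * X 2 - C m₀ * X 0 - C m₁ * X 1, ?_⟩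
      linear_combination q2
  subst hγ
  rw [C_0, zero_mul, add_zero] at h2
  refine ⟨degreeOf_add_mul_X_two_le (degreeOf_two_linear _ _) (degreeOf_C _ _), ?_, hl0, k, g 2,
    ?_, ?_⟩
  · rw [C_0, zero_mul, add_zero]
    exact degreeOf_add_mul_X_two_le (degreeOf_two_quadratic _ _ _) (degreeOf_two_linear _ _)
  · funext i
    fin_cases i
    · exact hk.trans (mul_comm _ _)
    · exact hk1.trans (mul_comm _ _)
    · rfl
  -- The inverse acts by the Möbius transformation `w / u` of degree `1` in `X 2`.
  set u : MvPolynomial (Fin 3) ℂ := (C (-d) * X 0 + C (-e') * X 1) + C α * X 2 with hu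
  set w : MvPolynomial (Fin 3) ℂ := (C c₀ * X 0 ^ 2 + C c₁ * (X 0 * X 1) + C c₂ * X 1 ^ 2) +
    (C (-a) * X 0 + C (-b) * X 1) * X 2 with hw
  have huw : g 2 * u = k * w := by
    refine mul_left_cancel₀ hk0 ?_
    simp only [hu, hw, C_neg]
    linear_combination -h2
  have hu0 : u ≠ 0 := by
    intro hz
    rw [hz, mul_zero] at huw
    have hwz := (mul_eq_zero.1 huw.symm).resolve_left hk0
    refine hlF ⟨X 2, ?_⟩
    simp only [hu, hw, C_neg] at hz hwz
    rw [C_0]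
    linear_combination hwz - X 2 * hz
  have hku : k ∣ u := hrel.dvd_of_dvd_mul_left (huw ▸ dvd_mul_right k w)
  have hmw : g 2 ∣ w := hrel.symm.dvd_of_dvd_mul_left (huw ▸ dvd_mul_right (g 2) u)
  refine ⟨(degreeOf_le_of_dvd hku hu0 2).trans
    (degreeOf_add_mul_X_two_le (degreeOf_two_linear _ _) (degreeOf_C _ _)), ?_, hk0⟩
  by_cases hw0 : w = 0
  · rw [hw0, mul_zero] at huw
    rw [(mul_eq_zero.1 huw).resolve_right hu0, degreeOf_zero]
    exact Nat.zero_le 1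
  · exact (degreeOf_le_of_dvd hmw hw0 2).trans
      (degreeOf_add_mul_X_two_le (degreeOf_two_quadratic _ _ _) (degreeOf_two_linear _ _))

theorem exists_bind₁_pencilMap_eq {l F P : MvPolynomial (Fin 3) ℂ} {D s : ℕ}
    (hl : degreeOf 2 l ≤ 1) (hF : degreeOf 2 F ≤ 1) (hP : P.IsHomogeneous D)
    (hs : degreeOf 2 P ≤ s) :
    ∃ Q, bind₁ (pencilMap l F) P = l ^ (D - s) * Q ∧ degreeOf 2 Q ≤ s := by
  have hm2 : ∀ m ∈ P.support, m 2 ≤ s := degreeOf_le_iff.1 hs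
  refine ⟨∑ m ∈ P.support, C (coeff m P) *
    (l ^ (m 0 + m 1 - (D - s)) * (X 0 ^ m 0 * (X 1 ^ m 1 * F ^ m 2))), ?_, ?_⟩
  · conv_lhs => rw [eq_sum_monomial_fin_three P]
    rw [map_sum, Finset.mul_sum]
    refine Finset.sum_congr rfl fun m hm => ?_
    have hm1 := exponents_sum_eq hP hm
    have hm2 := hm2 m hm
    simp only [map_mul, map_pow, bind₁_X_right, bind₁_C_right, pencilMap_zero, pencilMap_one,
      pencilMap_two]
    have : l ^ (m 0 + m 1) = l ^ (D - s) * l ^ (m 0 + m 1 - (D - s)) := by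
      rw [← pow_add]; congr 1; omega
    linear_combination (C (coeff m P) * X 0 ^ m 0 * X 1 ^ m 1 * F ^ m 2) * this
  · refine (degreeOf_sum_le _ _ _).trans (Finset.sup_le fun m hm => ?_)
    have hm1 := exponents_sum_eq hP hm
    have hm2 := hm2 m hm
    refine (degreeOf_C_mul_le _ _ _).trans ?_
    have e1 := degreeOf_mul_le 2 (l ^ (m 0 + m 1 - (D - s)))
      (X 0 ^ m 0 * (X 1 ^ m 1 * F ^ m 2) : MvPolynomial (Fin 3) ℂ)
    have e2 := degreeOf_mul_le 2 (X 0 ^ m 0) (X 1 ^ m 1 * F ^ m 2 : MvPolynomial (Fin 3) ℂ)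
    have e3 := degreeOf_mul_le 2 (X 1 ^ m 1) (F ^ m 2 : MvPolynomial (Fin 3) ℂ)
    have e4 := degreeOf_pow_le 2 l (m 0 + m 1 - (D - s))
    have e5 := degreeOf_pow_le 2 F (m 2)
    have e6 := Nat.mul_le_mul_left (m 0 + m 1 - (D - s)) hl
    have e7 := Nat.mul_le_mul_left (m 2) hF
    rw [degreeOf_X_pow_of_ne _ (by decide)] at e2 e3
    omega

/-- Composition with a map that acts by Möbius transformations on the lines through `[0 : 0 : 1]`
does not increase the degree along these lines, and the excess of the degree over it gives a common
factor. -/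
theorem degreeOf_two_le_of_pencilMap {l F h : MvPolynomial (Fin 3) ℂ} {ξ φ : Triple} {D s : ℕ}
    (hl : degreeOf 2 l ≤ 1) (hF : degreeOf 2 F ≤ 1) (hl0 : l ≠ 0)
    (hξ : ∀ i, (ξ i).IsHomogeneous D) (hs : ∀ i, degreeOf 2 (ξ i) ≤ s) (hφ : φ.NoCommonFactor)
    (hh : h ≠ 0) (hc : ∀ i, ξ.comp (pencilMap l F) i = h * φ i) :
    l ^ (D - s) ∣ h ∧ ∀ i, degreeOf 2 (φ i) ≤ s := by
  choose Q hQ hQs using fun i => exists_bind₁_pencilMap_eq hl hF (hξ i) (hs i)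
  have hd : l ^ (D - s) ∣ h := hφ.dvd_of_dvd_mul fun i => ⟨Q i, by rw [← hc i, ← hQ i]; rfl⟩
  refine ⟨hd, fun i => ?_⟩
  obtain ⟨c, rfl⟩ := hd
  have : c * φ i = Q i := by
    refine mul_left_cancel₀ (pow_ne_zero (D - s) hl0) ?_
    rw [← hQ i, ← mul_assoc, ← hc i]; rfl
  by_cases hφi : φ i = 0
  · rw [hφi, degreeOf_zero]; exact Nat.zero_le s
  · refine (degreeOf_le_of_dvd (this ▸ dvd_mul_left (φ i) c) ?_ 2).trans (hQs i)
    rw [← this]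
    exact mul_ne_zero (right_ne_zero_of_mul hh) hφi

/-- Inverting the first factor of a composition. -/
theorem exists_comp_inverse {ξ f g φ : Triple} {h : MvPolynomial (Fin 3) ℂ} {D r : ℕ}
    (hξ : ∀ i, (ξ i).IsHomogeneous D) (hξnc : ξ.NoCommonFactor) (hh : h ≠ 0)
    (hhom : h.IsHomogeneous r) (hinv : f.IsInverse g) (hc : ∀ i, ξ.comp f i = h * φ i) :
    ∃ k, k ≠ 0 ∧ ∀ i, φ.comp g i = k * ξ i := by
  obtain ⟨⟨u, hu, hgf⟩, ⟨v, hv, hfg⟩⟩ := hinv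
  have e1 : ∀ i, bind₁ g h * φ.comp g i = v ^ D * ξ i := fun i => by
    have h1 : bind₁ g (ξ.comp f i) = bind₁ g h * φ.comp g i := by rw [hc i, map_mul]; rfl
    rw [← h1, Triple.comp, bind₁_bind₁]
    have : (fun j => bind₁ g (f j)) = fun j => v * Triple.id j := funext hfg
    rw [this, bind₁_mul_of_isHomogeneous (hξ i)]
    congr 1
    exact congrFun (Triple.comp_id ξ) i
  have hgh : bind₁ g h ≠ 0 := by
    intro hz
    have : bind₁ f (bind₁ g h) = u ^ r * h := by
      rw [bind₁_bind₁]
      have e2 : (fun j => bind₁ f (g j)) = fun j => u * Triple.id j := funext hgf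
      rw [e2, bind₁_mul_of_isHomogeneous hhom]
      congr 1
      exact DFunLike.congr_fun (bind₁_X_left (σ := Fin 3) (R := ℂ)) h
    rw [hz, map_zero] at this
    exact mul_ne_zero (pow_ne_zero r hu) hh this.symm
  obtain ⟨k, hk⟩ := hξnc.dvd_of_dvd_mul fun i => Dvd.intro _ (e1 i)
  refine ⟨k, ?_, fun i => mul_left_cancel₀ hgh ?_⟩
  · rintro rfl
    rw [mul_zero] at hk
    exact pow_ne_zero D hv hk
  · rw [e1 i, hk, mul_assoc]

/-- A net of curves of degree `d` with multiplicity at least `d - 1` at `[1 : 0 : 0]` and at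
least `2` at `[0 : 0 : 1]` contains the line through these points. -/
theorem false_of_degreeOf_le {φ : Triple} {d : ℕ} (hφ : ∀ i, (φ i).IsHomogeneous d)
    (hnc : φ.NoCommonFactor) (h0 : ∀ i, degreeOf 0 (φ i) ≤ 1)
    (h2 : ∀ i, degreeOf 2 (φ i) + 2 ≤ d) : False := by
  have hX : IsUnit (X 1 : MvPolynomial (Fin 3) ℂ) := hnc _ fun i => by
    rw [eq_sum_monomial_fin_three (φ i)]
    refine Finset.dvd_sum fun m hm => ?_
    have a0 := degreeOf_le_iff.1 (h0 i) m hm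
    have a2 := degreeOf_le_iff.1 (le_refl (degreeOf 2 (φ i))) m hm
    have a1 := exponents_sum_eq (hφ i) hm
    have a3 := h2 i
    have : m 1 ≠ 0 := by omega
    exact ((dvd_pow_self (X 1) this).mul_left _).mul_right _ |>.mul_left _
  exact not_isUnit_of_isHomogeneous (isHomogeneous_X ℂ 1) one_ne_zero hX

/-! ### Quadratic maps -/

theorem Triple.IsInverse.linearIndependent {f g : Triple} (h : f.IsInverse g) (v : Fin 3 → ℂ)
    (hv : ∑ i, C (v i) * f i = 0) : v = 0 := by
  obtain ⟨-, ⟨k, hk, hfg⟩⟩ := h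
  have h1 := congrArg (bind₁ g) hv
  rw [map_sum, map_zero] at h1
  have h2 : k * ∑ i, C (v i) * X i = 0 := by
    rw [← h1, Finset.mul_sum]
    refine Finset.sum_congr rfl fun i _ => ?_
    have : bind₁ g (f i) = k * X i := hfg i
    rw [map_mul, bind₁_C_right, this]
    ring
  have h3 := (mul_eq_zero.1 h2).resolve_left hk
  funext i
  have := congrArg (eval (Pi.single i 1)) h3
  simpa [map_sum, Pi.single_apply] using this

theorem exists_mul_eq_one_of_det_ne_zero {A : Matrix (Fin 3) (Fin 3) ℂ} (h : A.det ≠ 0) :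
    ∃ A', A * A' = 1 :=
  ⟨A⁻¹, Matrix.mul_nonsing_inv A (isUnit_iff_ne_zero.2 h)⟩

theorem exists_det_ne_zero (u v : Fin 3 → ℂ)
    (h : ∀ s t : ℂ, (∀ i, s * u i + t * v i = 0) → s = 0 ∧ t = 0) :
    ∃ w, (Matrix.of ![u, v, w]).det ≠ 0 := by
  by_contra! hw
  have hdet : ∀ i, (crossProduct u v) i = 0 := fun i => by
    have := hw (Pi.single i 1)
    rw [Matrix.det_fin_three] at this
    rw [cross_apply]
    fin_cases i <;> simp at this ⊢ <;> linear_combination this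
  have hli : LinearIndependent ℂ ![u, v] := by
    rw [LinearIndependent.pair_iff]
    intro s t hst
    exact h s t fun i => congrFun hst i
  exact crossProduct_ne_zero_iff_linearIndependent.2 hli (funext hdet)

theorem exists_perm_matrix (σ : Equiv.Perm (Fin 3)) : ∃ P P' : Matrix (Fin 3) (Fin 3) ℂ,
    P * P' = 1 ∧ ∀ (f : Triple) i, (lin P).comp f i = f (σ i) := by
  refine ⟨Matrix.of fun i j => if j = σ i then 1 else 0,
    Matrix.of fun i j => if i = σ j then 1 else 0, ?_, ?_⟩
  · ext i j
    simp [Matrix.mul_apply, Matrix.one_apply, eq_comm]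
  · intro f i
    rw [lin_comp_apply]
    simp

/-- In suitable coordinates a quadratic birational map contracting a curve `p = 0` maps the lines
through a point to lines through a point, and the contracted curve is a line. -/
theorem exists_pencilMap {f g : Triple} (hf : ∀ i, (f i).IsHomogeneous 2)
    (hfnc : f.NoCommonFactor) (hinv : f.IsInverse g) {p : MvPolynomial (Fin 3) ℂ} (hp : Prime p)
    (hc : ∀ i j, i ≠ j → ∃ α β : ℂ, (α ≠ 0 ∨ β ≠ 0) ∧ p ∣ C α * f i + C β * f j) :
    p.IsHomogeneous 1 ∧ ∃ A A' B B' : Matrix (Fin 3) (Fin 3) ℂ, A * A' = 1 ∧ B * B' = 1 ∧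
      ∃ F, (lin B).comp (f.comp (lin A)) = pencilMap (bind₁ (lin A) p) F := by
  obtain ⟨c, hpc⟩ : ∃ c, ¬ p ∣ f c := by
    by_contra! hall
    exact hp.not_isUnit (hfnc p hall)
  have hl : ∀ j, j ≠ c → ∃ l : ℂ, p ∣ f j - C l * f c := by
    intro j hj
    obtain ⟨α, β, h0, hd⟩ := hc c j hj.symm
    have hβ : β ≠ 0 := by
      rintro rfl
      have hα : α ≠ 0 := by simpa using h0
      rw [C_0, zero_mul, add_zero, IsUnit.dvd_mul_left ((IsUnit.mk0 α hα).map C)] at hd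
      exact hpc hd
    refine ⟨-(β⁻¹ * α), ?_⟩
    have : f j - C (-(β⁻¹ * α)) * f c = C β⁻¹ * (C α * f c + C β * f j) := by
      have e : (C β⁻¹ * C β : MvPolynomial (Fin 3) ℂ) = 1 := by
        rw [← C_mul, inv_mul_cancel₀ hβ, C_1]
      simp only [C_neg, C_mul]
      linear_combination -(f j) * e
    rw [this]
    exact hd.mul_left _
  obtain ⟨σ, rfl⟩ : ∃ σ : Equiv.Perm (Fin 3), σ 2 = c := ⟨Equiv.swap c 2, by simp⟩
  obtain ⟨l₀, m₀, h0⟩ := hl (σ 0) (fun h => absurd (σ.injective h) (by decide))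
  obtain ⟨l₁, m₁, h1⟩ := hl (σ 1) (fun h => absurd (σ.injective h) (by decide))
  have hind : ∀ s t : ℂ, C s * m₀ + C t * m₁ = 0 → s = 0 ∧ t = 0 := by
    intro s t hst
    let v : Fin 3 → ℂ := ![s, t, -(s * l₀ + t * l₁)]
    have hz : ∑ i, C ((v ∘ σ.symm) i) * f i = 0 := by
      rw [← Equiv.sum_comp σ, Fin.sum_univ_three]
      simp only [Function.comp, Equiv.symm_apply_apply, v, Matrix.cons_val_zero,
        Matrix.cons_val_one, Matrix.cons_val, C_neg, C_add, C_mul]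
      linear_combination C s * h0 + C t * h1 + p * hst
    have hv := hinv.linearIndependent _ hz
    have hv' : ∀ i, v i = 0 := fun i => by simpa using congrFun hv (σ i)
    exact ⟨hv' 0, hv' 1⟩
  have hm0 : m₀ ≠ 0 := fun h => one_ne_zero (hind 1 0 (by simp [h])).1
  have hm1 : m₁ ≠ 0 := fun h => one_ne_zero (hind 0 1 (by simp [h])).2
  have hq : ∀ i (l : ℂ), (f i - C l * f (σ 2)).IsHomogeneous 2 := fun i l =>
    (hf i).sub ((hf (σ 2)).C_mul l)
  obtain ⟨a, b, hab, hpa, hmb⟩ := isHomogeneous_of_mul (h0 ▸ hq (σ 0) l₀) hp.ne_zero hm0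
  obtain ⟨a', b', hab', hpa', hmb'⟩ := isHomogeneous_of_mul (h1 ▸ hq (σ 1) l₁) hp.ne_zero hm1
  have haa : a = a' := hpa.inj_right hpa' hp.ne_zero
  have ha0 : a ≠ 0 := by
    rintro rfl
    exact hp.not_isUnit (isUnit_of_isHomogeneous_zero hpa hp.ne_zero)
  have hb0 : b ≠ 0 := by
    rintro rfl
    obtain rfl : b' = 0 := by omega
    rw [eq_C_of_isHomogeneous_zero hmb] at hind hm0
    rw [eq_C_of_isHomogeneous_zero hmb'] at hind
    have := (hind (coeff 0 m₁) (-coeff 0 m₀) (by rw [C_neg]; ring)).2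
    exact hm0 (by rw [neg_eq_zero.1 this, C_0])
  obtain rfl : a = 1 := by omega
  obtain rfl : b = 1 := by omega
  obtain rfl : b' = 1 := by omega
  refine ⟨hpa, ?_⟩
  obtain ⟨u₀, u₁, u₂, hu⟩ := exists_eq_of_isHomogeneous_one hmb
  obtain ⟨v₀, v₁, v₂, hv⟩ := exists_eq_of_isHomogeneous_one hmb'
  obtain ⟨w, hw⟩ := exists_det_ne_zero ![u₀, u₁, u₂] ![v₀, v₁, v₂] fun s t hst => by
    refine hind s t ?_
    have e0 := congrArg (C (σ := Fin 3)) (hst 0)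
    have e1 := congrArg (C (σ := Fin 3)) (hst 1)
    have e2 := congrArg (C (σ := Fin 3)) (hst 2)
    simp at e0 e1 e2
    rw [hu, hv]
    linear_combination X 0 * e0 + X 1 * e1 + X 2 * e2
  obtain ⟨A, hA⟩ := exists_mul_eq_one_of_det_ne_zero hw
  set M := Matrix.of ![![u₀, u₁, u₂], ![v₀, v₁, v₂], w] with hM
  have hMA : ∀ i, bind₁ (lin A) (lin M i) = X i := fun i => by
    have := congrFun (lin_comp_lin M A) i
    rwa [hA, lin_one] at this
  have hM0 : m₀ = lin M 0 := by
    rw [hu, lin, Fin.sum_univ_three]; simp [hM]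
  have hM1 : m₁ = lin M 1 := by
    rw [hv, lin, Fin.sum_univ_three]; simp [hM]
  obtain ⟨P, P', hP, hPf⟩ := exists_perm_matrix σ
  let T : Matrix (Fin 3) (Fin 3) ℂ := !![1, 0, -l₀; 0, 1, -l₁; 0, 0, 1]
  let T' : Matrix (Fin 3) (Fin 3) ℂ := !![1, 0, l₀; 0, 1, l₁; 0, 0, 1]
  have hT : T * T' = 1 := by
    ext i j
    fin_cases i <;> fin_cases j <;> simp [T, T', Matrix.mul_apply, Fin.sum_univ_three]
  refine ⟨A, M, T * P, P' * T', mul_eq_one_comm.1 hA, ?_, bind₁ (lin A) (f (σ 2)), ?_⟩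
  · rw [← mul_assoc, mul_assoc T, hP, mul_one, hT]
  · have hB : ∀ i, (lin (T * P)).comp f i = ∑ j, C (T i j) * f (σ j) := fun i => by
      rw [← lin_comp_lin, Triple.comp_assoc, lin_comp_apply]
      exact Finset.sum_congr rfl fun j _ => by rw [hPf]
    have hF : (lin (T * P)).comp f = ![p * m₀, p * m₁, f (σ 2)] := by
      funext i
      rw [hB, Fin.sum_univ_three]
      fin_cases i
      · simp [T, ← h0]; ring
      · simp [T, ← h1]; ring
      · simp [T]
    rw [← Triple.comp_assoc, hF]
    funext i
    fin_cases i
    · simp [Triple.comp, hM0, hMA]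
    · simp [Triple.comp, hM1, hMA]
    · simp [Triple.comp]

theorem prime_bind₁_lin {A A' : Matrix (Fin 3) (Fin 3) ℂ} (h : A * A' = 1)
    {p : MvPolynomial (Fin 3) ℂ} (hp : Prime p) : Prime (bind₁ (lin A) p) := by
  let E : MvPolynomial (Fin 3) ℂ ≃ₐ[ℂ] MvPolynomial (Fin 3) ℂ :=
    AlgEquiv.ofAlgHom (bind₁ (lin A)) (bind₁ (lin A'))
      (AlgHom.ext fun P => bind₁_lin_bind₁_lin (mul_eq_one_comm.1 h) P)
      (AlgHom.ext fun P => bind₁_lin_bind₁_lin h P)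
  exact (MulEquiv.prime_iff E).2 hp

/-- If a form vanishes along the contracted line `l = 0` after substitution of `[l x : l y : F]`,
then it vanishes at the image `[0 : 0 : 1]` of this line. -/
theorem degreeOf_two_add_one_le {l F P : MvPolynomial (Fin 3) ℂ} {D : ℕ} (hl : Prime l)
    (hlF : ¬ l ∣ F) (hP : P.IsHomogeneous D) (hD : 1 ≤ D) (h : l ∣ bind₁ (pencilMap l F) P) :
    degreeOf 2 P + 1 ≤ D := by
  suffices degreeOf 2 P ≤ D - 1 by omega
  refine degreeOf_le_iff.2 fun m hm => ?_
  by_contra hlt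
  have hm1 := exponents_sum_eq hP hm
  rw [eq_sum_monomial_fin_three P, map_sum, ← Finset.add_sum_erase _ _ hm] at h
  have hrest : l ∣ ∑ n ∈ P.support.erase m, bind₁ (pencilMap l F)
      (C (coeff n P) * (X 0 ^ n 0 * X 1 ^ n 1 * X 2 ^ n 2)) := by
    refine Finset.dvd_sum fun n hn => ?_
    obtain ⟨hnm, hn⟩ := Finset.mem_erase.1 hn
    have hn1 := exponents_sum_eq hP hn
    simp only [map_mul, map_pow, bind₁_X_right, bind₁_C_right, pencilMap_zero, pencilMap_one,
      pencilMap_two]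
    refine Dvd.dvd.mul_left (Dvd.dvd.mul_right ?_ _) _
    by_cases h0 : n 0 = 0
    · have h1 : n 1 ≠ 0 := by
        intro h1
        apply hnm
        ext i
        fin_cases i
        · change n 0 = m 0; omega
        · change n 1 = m 1; omega
        · change n 2 = m 2; omega
      exact Dvd.dvd.mul_left ((dvd_mul_right l _).trans (dvd_pow_self _ h1)) _
    · exact Dvd.dvd.mul_right ((dvd_mul_right l _).trans (dvd_pow_self _ h0)) _
  have hterm := (dvd_add_left hrest).1 h
  have h0 : m 0 = 0 := by omega
  have h1 : m 1 = 0 := by omega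
  simp only [map_mul, map_pow, bind₁_X_right, bind₁_C_right, pencilMap_two, h0,
    h1, pow_zero, one_mul] at hterm
  rw [IsUnit.dvd_mul_left ((IsUnit.mk0 _ (mem_support_iff.1 hm)).map C)] at hterm
  exact hlF (hl.dvd_of_dvd_pow hterm)

theorem degreeOf_lin_eq_zero {A : Matrix (Fin 3) (Fin 3) ℂ} {i j : Fin 3} (h : A i j = 0) :
    degreeOf j (lin A i) = 0 := by
  refine Nat.le_zero.1 ((degreeOf_sum_le _ _ _).trans (Finset.sup_le fun k _ => ?_))
  by_cases hk : k = j
  · rw [hk, h, C_0, zero_mul, degreeOf_zero]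
  · exact (degreeOf_C_mul_le _ _ _).trans (degreeOf_X_of_ne (Ne.symm hk)).le

theorem degreeOf_lin_le_one (A : Matrix (Fin 3) (Fin 3) ℂ) (i j : Fin 3) :
    degreeOf j (lin A i) ≤ 1 :=
  (degreeOf_le_totalDegree _ _).trans (lin_isHomogeneous A i).totalDegree_le

/-- If the point `[0 : 0 : 1]` and its image under `A` are different, a de Jonquières net with
`[0 : 0 : 1]` as its point of multiplicity `d - 1` has multiplicity at most `1` at the image. -/
theorem le_of_degreeOf_comp_lin_le {φ : Triple} {d s : ℕ} (hφ : ∀ i, (φ i).IsHomogeneous d)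
    (hnc : φ.NoCommonFactor) (h1 : ∀ i, degreeOf 2 (φ i) ≤ 1) {A A' : Matrix (Fin 3) (Fin 3) ℂ}
    (hA : A * A' = 1) (hne : ¬ (A 0 2 = 0 ∧ A 1 2 = 0))
    (hs : ∀ i, degreeOf 2 (φ.comp (lin A) i) ≤ s) : d ≤ s + 1 := by
  by_contra hlt
  -- Coordinates in which the two points are `[1 : 0 : 0]` and `[0 : 0 : 1]`.
  obtain ⟨M, M', hM, h00, h10, hcol⟩ : ∃ M M' : Matrix (Fin 3) (Fin 3) ℂ, M * M' = 1 ∧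
      M 0 0 = 0 ∧ M 1 0 = 0 ∧ ∀ i, M i 2 = A i 2 := by
    by_cases h0 : A 0 2 = 0
    · have h1 : A 1 2 ≠ 0 := fun h => hne ⟨h0, h⟩
      obtain ⟨M', hM'⟩ := exists_mul_eq_one_of_det_ne_zero
        (A := !![0, 1, A 0 2; 0, 0, A 1 2; 1, 0, A 2 2]) (by simpa [Matrix.det_fin_three] using h1)
      exact ⟨_, M', hM', rfl, rfl, fun i => by fin_cases i <;> rfl⟩
    · obtain ⟨M', hM'⟩ := exists_mul_eq_one_of_det_ne_zero
        (A := !![0, 0, A 0 2; 0, 1, A 1 2; 1, 0, A 2 2]) (by simpa [Matrix.det_fin_three] using h0)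
      exact ⟨_, M', hM', rfl, rfl, fun i => by fin_cases i <;> rfl⟩
  refine false_of_degreeOf_le (comp_lin_isHomogeneous M hφ) (hnc.comp_lin hM) (fun i => ?_)
    (fun i => ?_)
  · refine (degreeOf_bind₁_le_degreeOf (lin M) (φ i) 0 2 (fun k hk => degreeOf_lin_eq_zero ?_)
      (degreeOf_lin_le_one _ _ _)).trans (h1 i)
    fin_cases k
    · exact h00
    · exact h10
    · exact absurd rfl hk
  · have e : φ.comp (lin M) = (φ.comp (lin A)).comp (lin (A' * M)) := by
      rw [Triple.comp_assoc, lin_comp_lin, ← mul_assoc, hA, one_mul]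
    have hz : ∀ k, k ≠ 2 → (A' * M) k 2 = 0 := fun k hk => by
      have : (A' * M) k 2 = (A' * A) k 2 := by simp only [Matrix.mul_apply, hcol]
      rw [this, mul_eq_one_comm.1 hA, Matrix.one_apply_ne hk]
    have : degreeOf 2 (φ.comp (lin M) i) ≤ s := by
      rw [e]
      exact (degreeOf_bind₁_le_degreeOf (lin (A' * M)) (φ.comp (lin A) i) 2 2
        (fun k hk => degreeOf_lin_eq_zero (hz k hk)) (degreeOf_lin_le_one _ _ _)).trans (hs i)
    omega

/-- Let `ξ ∘ f` be a de Jonquières map of degree `d` with point `[0 : 0 : 1]`, up to the common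
factor `h`, where the quadratic map `f` contracts the line `p = 0` to a point `b`, which is moved
to `[0 : 0 : 1]` by a change of (σ 2)oordinates, and maps the lines through a base point `a` to those
through `b`. If `a` is `[0 : 0 : 1]`, then `ξ` is de Jonquières with point `b`; otherwise the
degree of `ξ` on the general line through `b` is at least `d - 1`. Moreover `b` is a base point of
`ξ` if `p` divides `ξ ∘ f`. -/
theorem exists_lin_of_comp_quadratic {f g ξ φ : Triple} {h p : MvPolynomial (Fin 3) ℂ}
    {d D e r : ℕ} (hf : ∀ i, (f i).IsHomogeneous 2) (hfnc : f.NoCommonFactor)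
    (hg : ∀ i, (g i).IsHomogeneous e) (hgnc : g.NoCommonFactor) (hinv : f.IsInverse g)
    (hξ : ∀ i, (ξ i).IsHomogeneous D) (hξnc : ξ.NoCommonFactor) (hD : 1 ≤ D)
    (hφ : ∀ i, (φ i).IsHomogeneous d) (hφnc : φ.NoCommonFactor) (h1 : ∀ i, degreeOf 2 (φ i) ≤ 1)
    (hh : h ≠ 0) (hr : h.IsHomogeneous r) (hc : ∀ i, ξ.comp f i = h * φ i) (hp : Prime p)
    (hcon : ∀ i j, i ≠ j → ∃ α β : ℂ, (α ≠ 0 ∨ β ≠ 0) ∧ p ∣ C α * f i + C β * f j) :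
    p.IsHomogeneous 1 ∧ ∃ B B' : Matrix (Fin 3) (Fin 3) ℂ, B * B' = 1 ∧
      ((∀ i, degreeOf 2 (ξ.comp (lin B') i) ≤ 1) ∧ p ^ (D - 1) ∣ h ∨
        ∀ s, (∀ i, degreeOf 2 (ξ.comp (lin B') i) ≤ s) → d ≤ s + 1) ∧
      ((∀ i, p ∣ ξ.comp f i) → ∀ i, degreeOf 2 (ξ.comp (lin B') i) + 1 ≤ D) := by
  obtain ⟨hp1, A, A', B, B', hA, hB, F, hF⟩ := exists_pencilMap hf hfnc hinv hp hcon
  have hA' : A' * A = 1 := mul_eq_one_comm.1 hA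
  have hB' : B' * B = 1 := mul_eq_one_comm.1 hB
  refine ⟨hp1, B, B', hB, ?_⟩
  set l := bind₁ (lin A) p with hl
  have hfA : ∀ i, ((lin B).comp (f.comp (lin A)) i).IsHomogeneous 2 :=
    lin_comp_isHomogeneous B (comp_lin_isHomogeneous A hf)
  have hfnc' : (pencilMap l F).NoCommonFactor := hF ▸ (hfnc.comp_lin hA).lin_comp hB
  have hinv' := hinv.conj hA hB
  rw [hF] at hfA hinv'
  have hl1 : l.IsHomogeneous 1 := by simpa using hp1.aeval (lin A) (lin_isHomogeneous A)
  obtain ⟨hdl, hdF, hl0, k, m, hgkm, hdk, hdm, hk0⟩ := pencilMap_inverse hl1 (hfA 2) hfnc'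
    (lin_comp_isHomogeneous A' (comp_lin_isHomogeneous B' hg))
    ((hgnc.comp_lin hB').lin_comp hA') hinv'
  rw [hgkm] at hinv'
  have hcomp : (ξ.comp (lin B')).comp (pencilMap l F) = (ξ.comp f).comp (lin A) := by
    rw [← hF, Triple.comp_assoc, lin_comp_lin_comp hB', Triple.comp_assoc]
  have hc' : ∀ i, (ξ.comp (lin B')).comp (pencilMap l F) i =
      bind₁ (lin A) h * φ.comp (lin A) i := fun i => by
    rw [hcomp, Triple.comp, hc i, map_mul]; rfl
  have hh' : bind₁ (lin A) h ≠ 0 := bind₁_lin_ne_zero hA hh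
  have hξ' := comp_lin_isHomogeneous B' hξ
  have hφ' := comp_lin_isHomogeneous A hφ
  have hφnc' := hφnc.comp_lin hA
  refine ⟨?_, fun hdvd i => ?_⟩
  · by_cases hpar : A 0 2 = 0 ∧ A 1 2 = 0
    · left
      have h1' : ∀ i, degreeOf 2 (φ.comp (lin A) i) ≤ 1 := fun i => by
        refine (degreeOf_bind₁_le_degreeOf (lin A) (φ i) 2 2
          (fun k hk => degreeOf_lin_eq_zero ?_) (degreeOf_lin_le_one _ _ _)).trans (h1 i)
        fin_cases k
        · exact hpar.1
        · exact hpar.2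
        · exact absurd rfl hk
      obtain ⟨q, hq, hqc⟩ := exists_comp_inverse hξ' (hξnc.comp_lin hB') hh'
        (r := r) (by simpa using hr.aeval (lin A) (lin_isHomogeneous A)) hinv' hc'
      have hξ1 := (degreeOf_two_le_of_pencilMap hdk hdm hk0 hφ' h1' (hξnc.comp_lin hB') hq hqc).2
      refine ⟨hξ1, ?_⟩
      have hd := (degreeOf_two_le_of_pencilMap hdl hdF hl0 hξ' hξ1 hφnc' hh' hc').1
      have := map_dvd (bind₁ (lin A')) hd
      rwa [hl, ← map_pow, bind₁_lin_bind₁_lin hA, bind₁_lin_bind₁_lin hA] at this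
    · right
      intro s hs
      exact le_of_degreeOf_comp_lin_le hφ hφnc h1 hA hpar
        (degreeOf_two_le_of_pencilMap hdl hdF hl0 hξ' hs hφnc' hh' hc').2
  · refine degreeOf_two_add_one_le (prime_bind₁_lin hA hp) (F := F) (fun hd => ?_) (hξ' i) hD ?_
    · refine not_isUnit_of_isHomogeneous hl1 one_ne_zero (hfnc' l fun i => ?_)
      fin_cases i
      · exact dvd_mul_right _ _
      · exact dvd_mul_right _ _
      · exact hd
    · have := map_dvd (bind₁ (lin A)) (hdvd i)
      have e1 := congrFun hcomp i
      rw [Triple.comp] at e1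
      rw [← hl, e1]
      exact this

/-! ### Compositions of two and of three quadratic maps -/

/-- The common factor of a composition is homogeneous of the expected degree. -/
theorem Triple.isHomogeneous_commonFactor {t s : Triple} {c : MvPolynomial (Fin 3) ℂ} {n b : ℕ}
    (ht : ∀ i, (t i).IsHomogeneous n) (hc : c ≠ 0) (hs : s.NoCommonFactor)
    (hb : ∀ i, (s i).IsHomogeneous b) (h : ∀ i, t i = c * s i) :
    ∃ r, r + b = n ∧ c.IsHomogeneous r := by
  obtain ⟨r, b', hr, hcr, hb'⟩ := Triple.isHomogeneous_of_mul ht hc hs.exists_ne_zero h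
  obtain ⟨i, hi⟩ := hs.exists_ne_zero
  exact ⟨r, (hb i).inj_right (hb' i) hi ▸ hr, hcr⟩

theorem exists_prime_dvd_of_isHomogeneous {h : MvPolynomial (Fin 3) ℂ} {r : ℕ}
    (hr : h.IsHomogeneous r) (hr0 : r ≠ 0) (hh : h ≠ 0) :
    ∃ (p : MvPolynomial (Fin 3) ℂ) (a : ℕ), Prime p ∧ p.IsHomogeneous a ∧ p ∣ h := by
  obtain ⟨p, hp, q, rfl⟩ :=
    WfDvdMonoid.exists_irreducible_factor (not_isUnit_of_isHomogeneous hr hr0) hh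
  obtain ⟨a, -, -, ha, -⟩ := isHomogeneous_of_mul hr hp.ne_zero (right_ne_zero_of_mul hh)
  exact ⟨p, a, hp.prime, ha, dvd_mul_right _ _⟩

theorem Triple.IsInverse.comp_lin {f g : Triple} (h : f.IsInverse g)
    {A A' : Matrix (Fin 3) (Fin 3) ℂ} (hA : A * A' = 1) :
    (f.comp (lin A)).IsInverse ((lin A').comp g) := by
  have := h.conj hA (mul_one (1 : Matrix (Fin 3) (Fin 3) ℂ))
  rwa [lin_one, Triple.id_comp, Triple.comp_id] at this

theorem comp_comp_lin {ξ f φ : Triple} {h : MvPolynomial (Fin 3) ℂ}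
    (hc : ∀ i, ξ.comp f i = h * φ i) (A : Matrix (Fin 3) (Fin 3) ℂ) (i : Fin 3) :
    ξ.comp (f.comp (lin A)) i = bind₁ (lin A) h * φ.comp (lin A) i := by
  rw [← Triple.comp_assoc, Triple.comp, hc i, map_mul]; rfl

/-- A composition of degree `4` of two quadratic maps has no triple point. -/
theorem false_of_comp_quadratic_quadratic {f g ξ φ : Triple} {h : MvPolynomial (Fin 3) ℂ} {e : ℕ}
    (hf : ∀ i, (f i).IsHomogeneous 2) (hfnc : f.NoCommonFactor)
    (hg : ∀ i, (g i).IsHomogeneous e) (hgnc : g.NoCommonFactor) (hinv : f.IsInverse g)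
    (hξ : ∀ i, (ξ i).IsHomogeneous 2) (hξnc : ξ.NoCommonFactor)
    (hφ : ∀ i, (φ i).IsHomogeneous 4) (hφnc : φ.NoCommonFactor)
    (hh : h ≠ 0) (hc : ∀ i, ξ.comp f i = h * φ i) {A A' : Matrix (Fin 3) (Fin 3) ℂ}
    (hA : A * A' = 1) (h1 : ∀ i, degreeOf 2 (φ.comp (lin A) i) ≤ 1) : False := by
  have hf' := comp_lin_isHomogeneous A hf
  have hfnc' := hfnc.comp_lin hA
  have hg' := lin_comp_isHomogeneous A' hg
  have hgnc' := hgnc.lin_comp (mul_eq_one_comm.1 hA)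
  have hinv' := hinv.comp_lin hA
  have hφ' := comp_lin_isHomogeneous A hφ
  have hφnc' := hφnc.comp_lin hA
  have hh' := bind₁_lin_ne_zero hA hh
  have hc' := comp_comp_lin hc A
  obtain ⟨r, hr, hhr⟩ := Triple.isHomogeneous_commonFactor
    (Triple.comp_isHomogeneous hξ hf') hh' hφnc' hφ' hc'
  obtain rfl : r = 0 := by omega
  have hu := isUnit_of_isHomogeneous_zero hhr hh'
  -- A contracted line is a factor of `u`, where `g ∘ f = u · id`.
  obtain ⟨u, hu0, hgf⟩ := hinv'.1
  obtain ⟨a, b, hab, hua, hb⟩ := Triple.isHomogeneous_of_mul (Triple.comp_isHomogeneous hg' hf')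
    hu0 (s := Triple.id) ⟨0, X_ne_zero 0⟩ hgf
  have hb1 : b = 1 := (hb 0).inj_right (isHomogeneous_X ℂ (0 : Fin 3)) (X_ne_zero 0)
  obtain ⟨p, k, hp, hpk, hpu⟩ := exists_prime_dvd_of_isHomogeneous hua (by omega) hu0
  have hcon := exists_dvd_linear_of_dvd_comp hgnc' two_ne_zero hf' hp hpk
    (fun i => hgf i ▸ hpu.mul_right _)
  obtain ⟨-, B, B', hB, hcases, -⟩ := exists_lin_of_comp_quadratic hf' hfnc' hg' hgnc' hinv' hξ
    hξnc one_le_two hφ' hφnc' h1 hh' hhr hc' hp hcon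
  rcases hcases with ⟨-, hd⟩ | hs
  · exact hp.not_isUnit (isUnit_of_dvd_unit (by simpa using hd) hu)
  · have := hs 2 fun i => (degreeOf_le_totalDegree _ _).trans
      (comp_lin_isHomogeneous B' hξ i).totalDegree_le
    omega

/-- A map of degree `5` with a point of multiplicity `4` is not the composition of a quadratic map
and of a map of degree at most `4`, if the latter has no triple point in case of degree `4`. -/
theorem false_of_comp_quadratic {f g ξ φ : Triple} {h : MvPolynomial (Fin 3) ℂ} {D e : ℕ}
    (hf : ∀ i, (f i).IsHomogeneous 2) (hfnc : f.NoCommonFactor)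
    (hg : ∀ i, (g i).IsHomogeneous e) (hgnc : g.NoCommonFactor) (hinv : f.IsInverse g)
    (hξ : ∀ i, (ξ i).IsHomogeneous D) (hξnc : ξ.NoCommonFactor) (hD : D ≤ 4)
    (hξJ : D = 4 → ∀ B B' : Matrix (Fin 3) (Fin 3) ℂ, B * B' = 1 →
      ¬ ∀ i, degreeOf 2 (ξ.comp (lin B) i) ≤ 1)
    (hφ : ∀ i, (φ i).IsHomogeneous 5) (hφnc : φ.NoCommonFactor)
    (hh : h ≠ 0) (hc : ∀ i, ξ.comp f i = h * φ i) {A A' : Matrix (Fin 3) (Fin 3) ℂ}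
    (hA : A * A' = 1) (h1 : ∀ i, degreeOf 2 (φ.comp (lin A) i) ≤ 1) : False := by
  have hf' := comp_lin_isHomogeneous A hf
  have hfnc' := hfnc.comp_lin hA
  have hg' := lin_comp_isHomogeneous A' hg
  have hgnc' := hgnc.lin_comp (mul_eq_one_comm.1 hA)
  have hinv' := hinv.comp_lin hA
  have hφ' := comp_lin_isHomogeneous A hφ
  have hφnc' := hφnc.comp_lin hA
  have hh' := bind₁_lin_ne_zero hA hh
  have hc' := comp_comp_lin hc A
  obtain ⟨r, hr, hhr⟩ := Triple.isHomogeneous_commonFactor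
    (Triple.comp_isHomogeneous hξ hf') hh' hφnc' hφ' hc'
  -- The common factor has odd degree `2 * D - 5`, and its prime factors are contracted.
  obtain ⟨p, k, hp, hpk, hph⟩ := exists_prime_dvd_of_isHomogeneous hhr (by omega) hh'
  have hpξ : ∀ i, p ∣ ξ.comp (f.comp (lin A)) i := fun i => hc' i ▸ hph.mul_right _
  have hcon := exists_dvd_linear_of_dvd_comp hξnc two_ne_zero hf' hp hpk hpξ
  obtain ⟨hp1, B, B', hB, hcases, hdeg⟩ := exists_lin_of_comp_quadratic hf' hfnc' hg' hgnc' hinv'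
    hξ hξnc (by omega) hφ' hφnc' h1 hh' hhr hc' hp hcon
  rcases hcases with ⟨hJ, hd⟩ | hs
  · obtain rfl | rfl : D = 3 ∨ D = 4 := by omega
    · obtain ⟨q, hq⟩ := hd
      rw [hq] at hhr hh'
      obtain ⟨a, b, hab, ha, -⟩ := isHomogeneous_of_mul hhr (left_ne_zero_of_mul hh')
        (right_ne_zero_of_mul hh')
      have := ha.inj_right (hp1.pow (3 - 1)) (left_ne_zero_of_mul hh')
      omega
    · exact hξJ rfl B' B (mul_eq_one_comm.1 hB) hJ
  · have := hs (D - 1) fun i => by have := hdeg hpξ i; omega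
    omega

end PlaneCremona

namespace PlaneCremonaMap

open PlaneCremona

theorem IsComp.exists_commonFactor {φ ψ χ : PlaneCremonaMap} (h : φ.IsComp ψ χ) :
    ∃ (c : MvPolynomial (Fin 3) ℂ) (r : ℕ), c ≠ 0 ∧ c.IsHomogeneous r ∧
      r + φ.deg = χ.deg * ψ.deg ∧ ∀ i, ψ.formula.comp χ.formula i = c * φ.formula i := by
  obtain ⟨c, hc, hi⟩ := h
  obtain ⟨r, hr, hcr⟩ := Triple.isHomogeneous_commonFactor
    (Triple.comp_isHomogeneous ψ.homogeneous χ.homogeneous) hc φ.no_common_factor φ.homogeneous hi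
  exact ⟨c, r, hc, hcr, hr, hi⟩

theorem IsComp.deg_le {φ ψ χ : PlaneCremonaMap} (h : φ.IsComp ψ χ) :
    φ.deg ≤ χ.deg * ψ.deg := by
  obtain ⟨-, r, -, -, hr, -⟩ := h.exists_commonFactor
  omega

theorem QuadraticDecomposition.deg_le {n : ℕ} {φ : PlaneCremonaMap}
    (h : QuadraticDecomposition n φ) : φ.deg ≤ 2 ^ n := by
  induction h with
  | aut α hα => exact le_of_eq hα
  | step n φ ψ ρ _ hρ hc ih =>
    have h1 := hc.deg_le
    have h2 : ρ.deg = 2 := hρ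
    rw [h2] at h1
    calc φ.deg ≤ ψ.deg * 2 := h1
      _ ≤ 2 ^ n * 2 := Nat.mul_le_mul_right _ ih
      _ = 2 ^ (n + 1) := (pow_succ _ _).symm

/-! ### The two inequalities -/

/-- An automorphism composed with the elementary quadratic transformation is quadratic. -/
theorem IsComp.isQuadratic_of_sigma {ρ α : PlaneCremonaMap} (hα : α.IsAutomorphism)
    (h : ρ.IsComp α sigma) : ρ.IsQuadratic := by
  obtain ⟨c, r, hc, hcr, hr, hi⟩ := h.exists_commonFactor
  have hα1 : α.deg = 1 := hα
  have hs2 : sigma.deg = 2 := rfl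
  rw [hα1, hs2] at hr
  obtain ⟨e, g, -, -, hinv⟩ := Triple.exists_inverse α.homogeneous α.birational
  have hlin : ∀ i, ∃ v : Fin 3 → ℂ, α.formula i = ∑ j, C (v j) * X j := fun i => by
    obtain ⟨a, b, c, habc⟩ := exists_eq_of_isHomogeneous_one (hα1 ▸ α.homogeneous i)
    exact ⟨![a, b, c], by rw [habc, Fin.sum_univ_three]; rfl⟩
  choose M hM using hlin
  have hαM : α.formula = lin (Matrix.of M) := funext hM
  have hdet : (Matrix.of M).det ≠ 0 := by
    intro hdet
    obtain ⟨v, hv, hvM⟩ := Matrix.exists_vecMul_eq_zero_iff.2 hdet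
    refine hv (hinv.linearIndependent v ?_)
    simp only [hM, Finset.mul_sum]
    rw [Finset.sum_comm]
    refine Finset.sum_eq_zero fun j _ => ?_
    have := congrArg (C (σ := Fin 3)) (congrFun hvM j)
    simp only [Matrix.vecMul, dotProduct, map_sum, C_mul, Matrix.of_apply, Pi.zero_apply, C_0]
      at this
    rw [← zero_mul (X j), ← this, Finset.sum_mul]
    exact Finset.sum_congr rfl fun i _ => by ring
  obtain ⟨M', hM'⟩ := exists_mul_eq_one_of_det_ne_zero hdet
  have hu : IsUnit c := sigma.no_common_factor c fun i => by
    rw [← lin_comp_lin_comp (mul_eq_one_comm.1 hM') sigma.formula, ← hαM, lin_comp_apply]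
    exact Finset.dvd_sum fun j _ => (hi j ▸ dvd_mul_right c _).mul_left _
  have hr0 : r = 0 := by
    by_contra hr0
    exact not_isUnit_of_isHomogeneous hcr hr0 hu
  change ρ.deg = 2
  omega

theorem OrdinaryDecomposition.quadraticDecomposition {n : ℕ} {φ : PlaneCremonaMap}
    (h : OrdinaryDecomposition n φ) : QuadraticDecomposition n φ := by
  induction h with
  | aut α hα => exact .aut α hα
  | step n φ ψ α ρ _ hα hρ hc ih => exact .step n φ ψ ρ ih (hρ.isQuadratic_of_sigma hα) hc

theorem IsDeJonquieres.deg_ne_four {φ : PlaneCremonaMap} (hφ : φ.IsDeJonquieres)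
    (h : QuadraticDecomposition 2 φ) : φ.deg ≠ 4 := by
  intro hd
  obtain ⟨A, A', hA, h1⟩ := hφ.exists_lin
  obtain _ | ⟨_, _, ψ, ρ, hψ, hρ, hc⟩ := h
  have hρ2 : ρ.deg = 2 := hρ
  have hψ1 : ψ.deg ≤ 2 := hψ.deg_le
  have hle := hc.deg_le
  have hψ2 : ψ.deg = 2 := by rw [hρ2] at hle; omega
  obtain ⟨e, g, hg, hgnc, hinv⟩ := Triple.exists_inverse ψ.homogeneous ψ.birational
  obtain ⟨c, hc0, hci⟩ := hc
  exact false_of_comp_quadratic_quadratic (hψ2 ▸ ψ.homogeneous) ψ.no_common_factor hg hgnc hinv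
    (hρ2 ▸ ρ.homogeneous) ρ.no_common_factor (hd ▸ φ.homogeneous) φ.no_common_factor hc0 hci hA h1

theorem IsDeJonquieres.deg_ne_five {φ : PlaneCremonaMap} (hφ : φ.IsDeJonquieres)
    (h : QuadraticDecomposition 3 φ) : φ.deg ≠ 5 := by
  intro hd
  obtain ⟨A, A', hA, h1⟩ := hφ.exists_lin
  obtain _ | ⟨_, _, ψ, ρ, hψ, hρ, hc⟩ := h
  obtain _ | ⟨_, _, χ, τ, hχ, hτ, hc'⟩ := hψ
  have hρ2 : ρ.deg = 2 := hρ
  have hτ2 : τ.deg = 2 := hτ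
  have hχ1 : χ.deg ≤ 2 := hχ.deg_le
  have hle := hc.deg_le
  have hle' := hc'.deg_le
  have hχ2 : χ.deg = 2 := by rw [hρ2] at hle; rw [hτ2] at hle'; omega
  obtain ⟨e, g, hg, hgnc, hinv⟩ := Triple.exists_inverse χ.homogeneous χ.birational
  obtain ⟨e', g', hg', hgnc', hinv'⟩ := Triple.exists_inverse τ.homogeneous τ.birational
  obtain ⟨c, hc0, hci⟩ := hc
  obtain ⟨c', hc0', hci'⟩ := hc'
  -- Bracket the composition as `(ρ ∘ τ) ∘ χ`.
  have hcomp : ∀ i, (ρ.formula.comp τ.formula).comp χ.formula i =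
      c' ^ ρ.deg * c * φ.formula i := fun i => by
    rw [Triple.comp_assoc]
    have : τ.formula.comp χ.formula = fun j => c' * ψ.formula j := funext hci'
    rw [this, Triple.comp, bind₁_mul_of_isHomogeneous (ρ.homogeneous i), mul_assoc, ← hci i]
    rfl
  have hcc : c' ^ ρ.deg * c ≠ 0 := mul_ne_zero (pow_ne_zero _ hc0') hc0
  have hne : ∃ i, ρ.formula.comp τ.formula i ≠ 0 := by
    obtain ⟨i, hi⟩ := Triple.NoCommonFactor.exists_ne_zero φ.no_common_factor
    refine ⟨i, fun hz => mul_ne_zero hcc hi ?_⟩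
    rw [← hcomp i, Triple.comp, hz, map_zero]
  obtain ⟨u, ξ, hu, hξnc, huξ⟩ := Triple.exists_eq_mul_noCommonFactor _ hne
  obtain ⟨a, D, haD, -, hξ⟩ := Triple.isHomogeneous_of_mul
    (Triple.comp_isHomogeneous ρ.homogeneous τ.homogeneous) hu hξnc.exists_ne_zero huξ
  have hcomp' : ∀ i, bind₁ χ.formula u * ξ.comp χ.formula i =
      c' ^ ρ.deg * c * φ.formula i := fun i => by
    rw [← hcomp i, Triple.comp, Triple.comp, huξ i, map_mul]
  obtain ⟨q, hq⟩ := Triple.NoCommonFactor.dvd_of_dvd_mul φ.no_common_factor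
    fun i => Dvd.intro _ (hcomp' i)
  rw [hq] at hcc hcomp'
  refine false_of_comp_quadratic (D := D) (hχ2 ▸ χ.homogeneous) χ.no_common_factor hg hgnc hinv hξ
    hξnc (by rw [hρ2, hτ2] at haD; omega) (fun hD B B' hB hJ => ?_) (hd ▸ φ.homogeneous)
    φ.no_common_factor (right_ne_zero_of_mul hcc) (fun i => ?_) hA h1
  · exact false_of_comp_quadratic_quadratic (hτ2 ▸ τ.homogeneous) τ.no_common_factor hg' hgnc'
      hinv' (hρ2 ▸ ρ.homogeneous) ρ.no_common_factor (hD ▸ hξ) hξnc hu huξ hB hJ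
  · refine mul_left_cancel₀ (left_ne_zero_of_mul hcc) ?_
    rw [hcomp' i, mul_assoc]

end PlaneCremonaMap

end

theorem lemma5 (φ : PlaneCremonaMap) (hφ : φ.IsDeJonquieres) (hd : φ.deg ≤ 5) :
    φ.quadraticLength ≤ φ.ordinaryQuadraticLength ∧
      ((φ.deg - 1 : ℕ) : ℕ∞) ≤ φ.quadraticLength := by
  constructor
  · exact le_iInf₂ fun n hn => iInf₂_le n hn.quadraticDecomposition
  · refine le_iInf₂ fun n hn => Nat.cast_le.2 ?_
    have h1 := hn.deg_le
    by_contra hlt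
    obtain rfl | rfl | rfl | rfl : n = 0 ∨ n = 1 ∨ n = 2 ∨ n = 3 := by omega
    · omega
    · omega
    · have := hφ.deg_ne_four hn
      omega
    · have := hφ.deg_ne_five hn
      omega
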